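/- **Setting.** A tensor network is a hypergraph $G=(V,E,w)$: vertices are tensors, a hyperedge $e$ is a dimension of size $\exp(w(e))$, a positive integer, and has at least two ends, one of which may be dangling (then $e$ is uncontracted). For $A,B\subseteq V$ let $E(A,B)$ be the set of hyperedges adjacent to both $A$ and $B$, and $E(A)=E(A,V\setminus A)\cup E(A,*)$, where $E(A,*)$ is the set of uncontracted hyperedges adjacent to $A$ only. Put $\mathrm{cut}_G(A,B)=\sum_{e\in E(A,B)}w(e)$ and $\mathrm{cut}_G(A)=\sum_{e\in E(A)}w(e)$. A contraction tree is a rooted binary tree whose leaves are the tensors, each exactly once; its inner vertices are contractions $(A,B)$ of disjoint vertex sets. Each contraction costs $\exp(\mathrm{cut}_G(A)+\mathrm{cut}_G(B)-\mathrm{cut}_G(A,B))$, and the cost of a tree is the sum over its contractions. The data is a tensor network $G_D=(V_D,E_D,w)$ with a set $\bar E=\{e_1,\dots,e_N\}\subseteq E_D$ of edges to be sketched: each $e_j$ is uncontracted in $G_D$ and adjacent to exactly one tensor $v_j$, and the $v_j$ are distinct (some tensors may have no sketched edge). Let $s_j$ be the size of $e_j$. Let $R$ be the network of all data edges outside $\bar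 E$. Let $T_0$ be a contraction tree of $G_D$ with contractions $(U_i,V_i)$, $1\le i\le |V_D|-1$. Put $a_i=\exp(\mathrm{cut}_R(U_i)-\mathrm{cut}_R(U_i,V_i))$, $c_i=\exp(\mathrm{cut}_R(V_i)-\mathrm{cut}_R(U_i,V_i))$, $d_i=\exp(\mathrm{cut}_R(U_i\cup V_i))/(a_ic_i)$, $b_i=\exp(\mathrm{cut}_R(U_i,V_i))/d_i$. Let $\mathcal S$ be the set of those $i$ for which both $U_i$ and $V_i$ are adjacent to $\bar E$, $\mathcal D(e_j)$ the set of those $i$ for which $e_j$ is the only edge of $\bar E$ adjacent to $U_i\cup V_i$, and $\mathcal I$ the set of all other $i$. Let $X(e_j)=\{v_j\}\cup\bigcup_{i\in\mathcal D(e_j)}(U_i\cup V_i)$. An embedding $G_E=(V_E,E_E,w)$ with $N_E=|V_E|$ is a graph tensor network with $\bar E\subseteq E_E$. Each $e_j$ connects $v_j$ to one embedding tensor, exactly one further edge is uncontracted (the output edge, of size $m$), and every other edge connects two embedding tensors. Let $G=(G_D,G_E)$ be the overall network. A linearization is an ordering of the embedding tensors; all data tensors come before them, contracted embedding edges are directed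 to the later end, and the output edge is directed outward. This gives a directed acyclic graph $G_S$, and $\mathrm{cut}_{G_S}(A)$ is the total weight of the embedding edges leaving $A$. A contraction tree $T_B$ of $G$ is constrained on $T_0$ if for every contraction $(A,B)$ of $T_0$ there is a contraction $(\hat A,\hat B)$ of $T_B$ with $\hat A\cap V_D=A$ and $\hat B\cap V_D=B$ (contractions are unordered pairs). For positive constants $\kappa,\kappa_1,\kappa_2$ and $\epsilon>0$, $0<\delta<1$, put $K=N_E\log(1/\delta)/\epsilon^2$. The embedding is admissible if for some linearization $\exp(\mathrm{cut}_{G_S}(v))\ge\kappa K$ for all $v\in V_E$, and $\kappa_1K\le m\le\kappa_2K$. Let $t_j$ be the optimal cost of sketching the subnetwork $X(e_j)$ with one matrix of size $m\times s_j$ attached to $e_j$. That is, $t_j$ is the minimal cost of a contraction tree of $X(e_j)$ together with this matrix (edges of $G_D$ leaving $X(e_j)$ counting as uncontracted) that is constrained on the contractions of $T_0$ inside $X(e_j)$. Let $z_i=a_ib_ic_id_i\cdot\min(\exp(\mathrm{cut}_{G_S}(U_i\cup V_i)),m)$. **Theorem.** For all positive constants $\kappa,\kappa_1,\kappa_2$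 there is a constant $C>0$ such that the following holds for all $\epsilon>0$, $0<\delta<1$, all data networks $G_D$ with a contraction tree $T_0$, all admissible embeddings $G_E$ whose sketch size satisfies $m<s_j$ for every $j$, and all contraction trees $T_B$ of $(G_D,G_E)$ constrained on $T_0$. The cost of $T_B$ is at least $$C\Bigl(\sum_{j=1}^N t_j+\sum_{i\in\mathcal S}a_ib_ic_id_i\,m^2+N m^{2.5}+\sum_{i\in\mathcal I}z_i\Bigr)$$ if $N\ge 2$, and at least the same expression without the term $Nm^{2.5}$ if $N\le 1$. -/

import Mathlib

open Finset

/-- A tensor network, given as an undirected hypergraph on the vertex set `V` (the tensors) with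
hyperedges `E` (the dimensions).  `inc e` is the set of vertices adjacent to `e`, `dangling e` says
that `e` has a dangling end (it is uncontracted), and `size e` is the dimension size of `e`. Every
hyperedge has at least two ends, one of which may be the dangling one. Several hyperedges may be
adjacent to the same vertices. -/
structure TensorNetwork (V E : Type*) where
  inc : E → Finset V
  dangling : E → Bool
  size : E → ℕ
  size_pos : ∀ e, 0 < size e
  two_ends : ∀ e, 2 ≤ (inc e).card + (dangling e).toNat

namespace TensorNetwork

variable {V E : Type*} [Fintype V] [DecidableEq V] [Fintype E] [DecidableEq E]

/-- `w(e)`, the natural logarithm of the dimension size. -/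
noncomputable def weight (G : TensorNetwork V E) (e : E) : ℝ := Real.log (G.size e)

/-- `E(A, B)`: the hyperedges adjacent to both `A` and `B`. -/
def edgesBetween (G : TensorNetwork V E) (A B : Finset V) : Finset E :=
  univ.filter fun e => (∃ v ∈ G.inc e, v ∈ A) ∧ (∃ v ∈ G.inc e, v ∈ B)

/-- `E(A, *)`: the uncontracted hyperedges adjacent to `A` only. -/
def edgesDangling (G : TensorNetwork V E) (A : Finset V) : Finset E :=
  univ.filter fun e => G.dangling e = true ∧ G.inc e ⊆ A

/-- `E(A) = E(A, V \ A) ∪ E(A, *)`: the dimensions of the contraction output of `A`. -/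
def edgesOut (G : TensorNetwork V E) (A : Finset V) : Finset E :=
  G.edgesBetween A (univ \ A) ∪ G.edgesDangling A

/-- `cut_G(A, B)`. -/
noncomputable def cutBetween (G : TensorNetwork V E) (A B : Finset V) : ℝ :=
  ∑ e ∈ G.edgesBetween A B, G.weight e

/-- `cut_G(A)`. -/
noncomputable def cut (G : TensorNetwork V E) (A : Finset V) : ℝ :=
  ∑ e ∈ G.edgesOut A, G.weight e

/-- `cost_G(A, B) = cut_G(A) + cut_G(B) - cut_G(A, B)`: the logarithm of the cost of contracting
the contraction outputs of `A` and `B` with classical dense matrix multiplication. -/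
noncomputable def logCost (G : TensorNetwork V E) (A B : Finset V) : ℝ :=
  G.cut A + G.cut B - G.cutBetween A B

/-- The same vertices with only the hyperedges in `S`. -/
def restrict (G : TensorNetwork V E) (S : Finset E) : TensorNetwork V {e // e ∈ S} where
  inc e := G.inc e
  dangling e := G.dangling e
  size e := G.size e
  size_pos e := G.size_pos e
  two_ends e := G.two_ends e

end TensorNetwork

/-- Rooted binary trees with leaves labelled by `V`. -/
inductive ContractionTree (V : Type*) where
  | leaf (v : V) : ContractionTree V
  | node (l r : ContractionTree V) : ContractionTree V

namespace ContractionTree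

variable {V : Type*} [DecidableEq V]

/-- The set of vertices contracted by the tree. -/
def verts : ContractionTree V → Finset V
  | leaf v => {v}
  | node l r => l.verts ∪ r.verts

/-- The contractions `(W₁, W₂)` of the tree, one for each inner vertex. -/
def contractions : ContractionTree V → Finset (Finset V × Finset V)
  | leaf _ => ∅
  | node l r => insert (l.verts, r.verts) (l.contractions ∪ r.contractions)

/-- The two children of every inner vertex are disjoint, so no tensor is used twice. -/
def Proper : ContractionTree V → Prop
  | leaf _ => True
  | node l r => l.Proper ∧ r.Proper ∧ Disjoint l.verts r.verts

/-- `T` is a contraction tree of the tensors in `A`: each of them occurs at exactly one leaf. -/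
def IsTreeOf (T : ContractionTree V) (A : Finset V) : Prop := T.Proper ∧ T.verts = A

/-- The cost of a contraction tree: the sum of the costs of its contractions. -/
noncomputable def cost {E : Type*} [Fintype V] [Fintype E] [DecidableEq E]
    (T : ContractionTree V) (G : TensorNetwork V E) : ℝ :=
  ∑ p ∈ T.contractions, Real.exp (G.logCost p.1 p.2)

/-- Every contraction `(A, B)` among the contractions `C` of data tensors is matched by a
contraction of `T` whose two inputs meet the data vertices (the left summand) in `A` and `B`.
The two inputs of a contraction are unordered. -/
def RespectsContractions {VD VE : Type*} [DecidableEq VD] [DecidableEq VE]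
    (T : ContractionTree (VD ⊕ VE)) (C : Finset (Finset VD × Finset VD)) : Prop :=
  ∀ p ∈ C, ∃ q ∈ T.contractions,
    (q.1.toLeft = p.1 ∧ q.2.toLeft = p.2) ∨ (q.1.toLeft = p.2 ∧ q.2.toLeft = p.1)

/-- `T` is constrained on the data contraction tree `T₀`. -/
def ConstrainedOn {VD VE : Type*} [DecidableEq VD] [DecidableEq VE]
    (T : ContractionTree (VD ⊕ VE)) (T₀ : ContractionTree VD) : Prop :=
  T.RespectsContractions T₀.contractions

end ContractionTree

/-- A data tensor network with its set `sketched` of edges to be sketched. Each of these is an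
uncontracted edge of the data adjacent to exactly one tensor, `vertex e`, and each tensor is
adjacent to at most one of them. All other hyperedges are arbitrary. -/
structure DataNetwork (VD ED : Type*) extends TensorNetwork VD ED where
  sketched : Finset ED
  vertex : {e // e ∈ sketched} → VD
  vertex_injective : Function.Injective vertex
  inc_sketched : ∀ e : {e // e ∈ sketched}, inc e = {vertex e}
  dangling_sketched : ∀ e : {e // e ∈ sketched}, dangling e = true

namespace DataNetwork

variable {VD ED : Type*} [Fintype VD] [DecidableEq VD] [Fintype ED] [DecidableEq ED]

/-- The index type of the edges `e₁, …, e_N` to be sketched. -/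
abbrev Sketched (D : DataNetwork VD ED) : Type _ := {e // e ∈ D.sketched}

/-- The number `N` of edges to be sketched. -/
def order (D : DataNetwork VD ED) : ℕ := D.sketched.card

/-- The network `R` of the data edges that are not sketched. (Embedding vertices are isolated in
`R`, hence are left out.) -/
def rest (D : DataNetwork VD ED) : TensorNetwork VD {e // e ∈ univ \ D.sketched} :=
  D.toTensorNetwork.restrict (univ \ D.sketched)

/-- The edges to be sketched that are adjacent to `A`. -/
def sketchedAt (D : DataNetwork VD ED) (A : Finset VD) : Finset D.Sketched :=
  univ.filter fun e => D.vertex e ∈ A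

/-- `a = exp(cut_R(U) - cut_R(U, V))` for the contraction `p = (U, V)`. -/
noncomputable def aSize (D : DataNetwork VD ED) (p : Finset VD × Finset VD) : ℝ :=
  Real.exp (D.rest.cut p.1 - D.rest.cutBetween p.1 p.2)

/-- `c = exp(cut_R(V) - cut_R(U, V))`. -/
noncomputable def cSize (D : DataNetwork VD ED) (p : Finset VD × Finset VD) : ℝ :=
  Real.exp (D.rest.cut p.2 - D.rest.cutBetween p.1 p.2)

/-- `d = exp(cut_R(U ∪ V)) / (a c)`. -/
noncomputable def dSize (D : DataNetwork VD ED) (p : Finset VD × Finset VD) : ℝ :=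
  Real.exp (D.rest.cut (p.1 ∪ p.2)) / (D.aSize p * D.cSize p)

/-- `b = exp(cut_R(U, V)) / d`. -/
noncomputable def bSize (D : DataNetwork VD ED) (p : Finset VD × Finset VD) : ℝ :=
  Real.exp (D.rest.cutBetween p.1 p.2) / D.dSize p

/-- The class `𝒮`: contractions both of whose inputs are adjacent to edges to be sketched. -/
def classS (D : DataNetwork VD ED) (T₀ : ContractionTree VD) : Finset (Finset VD × Finset VD) :=
  T₀.contractions.filter fun p => (D.sketchedAt p.1).Nonempty ∧ (D.sketchedAt p.2).Nonempty

/-- The class `𝒟(e_j)`: contractions whose output is adjacent to the sketched edge `j` and to no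
other one. -/
def classD (D : DataNetwork VD ED) (T₀ : ContractionTree VD) (j : D.Sketched) :
    Finset (Finset VD × Finset VD) :=
  T₀.contractions.filter fun p => D.sketchedAt (p.1 ∪ p.2) = {j}

/-- The class `ℐ` of all remaining contractions. -/
def classI (D : DataNetwork VD ED) (T₀ : ContractionTree VD) : Finset (Finset VD × Finset VD) :=
  T₀.contractions.filter fun p => p ∉ D.classS T₀ ∧ ∀ j, p ∉ D.classD T₀ j

/-- `X(e_j)`: the tensors contracted by `𝒟(e_j)`, and just `v_j` if `𝒟(e_j)` is empty. -/
def subnet (D : DataNetwork VD ED) (T₀ : ContractionTree VD) (j : D.Sketched) : Finset VD :=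
  insert (D.vertex j) ((D.classD T₀ j).biUnion fun p => p.1 ∪ p.2)

/-- The data together with a single sketching matrix of size `m × s_j`, the vertex `inr ()`: its
column dimension is the sketched edge `j`, and its row dimension, of size `m`, is uncontracted. -/
def withMatrix (D : DataNetwork VD ED) (j : D.Sketched) (m : ℕ) (hm : 0 < m) :
    TensorNetwork (VD ⊕ Unit) (ED ⊕ Unit) where
  inc
    | Sum.inl e => (D.inc e).disjSum (if e = j.1 then {()} else ∅)
    | Sum.inr _ => {Sum.inr ()}
  dangling
    | Sum.inl e => D.dangling e && decide (e ≠ j.1)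
    | Sum.inr _ => true
  size
    | Sum.inl e => D.size e
    | Sum.inr _ => m
  size_pos := by
    rintro (e | e)
    · exact D.size_pos e
    · exact hm
  two_ends := by
    rintro (e | e)
    · by_cases h : e = j.1
      · subst h
        simp [D.inc_sketched j]
      · simpa [h] using D.two_ends e
    · simp

/-- `t_j`: the optimal cost of sketching the subnetwork `X(e_j)` with a sketching matrix of output
size `m` attached to `e_j`. The contraction trees of `X(e_j)` and the matrix are subject to the
same constraint as everywhere: they respect the contractions of `T₀` inside `X(e_j)`. Edges leaving
`X(e_j)` are uncontracted dimensions of the subnetwork. -/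
noncomputable def sketchCost (D : DataNetwork VD ED) (T₀ : ContractionTree VD) (j : D.Sketched)
    (m : ℕ) (hm : 0 < m) : ℝ :=
  sInf {x : ℝ | ∃ T : ContractionTree (VD ⊕ Unit),
    T.IsTreeOf ((D.subnet T₀ j).disjSum {()}) ∧
    T.RespectsContractions
      (T₀.contractions.filter fun p => p.1 ∪ p.2 ⊆ D.subnet T₀ j) ∧
    x = T.cost (D.withMatrix j m hm)}

end DataNetwork

/-- A graph tensor network embedding of the data `D` with embedding tensors `VE`. Its edges are
the sketched edges of `D`, each of which connects its data tensor to one embedding tensor; the inner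
edges `FE`, each of which connects two embedding tensors; and a single uncontracted edge, the output
sketch dimension, of size `m`. -/
structure Embedding {VD ED : Type*} (D : DataNetwork VD ED) (VE FE : Type*) where
  attach : {e // e ∈ D.sketched} → VE
  ends : FE → Finset VE
  ends_card : ∀ f, (ends f).card = 2
  innerSize : FE → ℕ
  innerSize_pos : ∀ f, 0 < innerSize f
  out : VE
  m : ℕ
  m_pos : 0 < m

namespace Embedding

variable {VD ED VE FE : Type*} [Fintype VD] [DecidableEq VD] [Fintype ED] [DecidableEq ED]
  [Fintype VE] [DecidableEq VE] [Fintype FE] [DecidableEq FE] {D : DataNetwork VD ED}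

/-- The overall network `G = (G_D, G_E)`. Its edges are the data edges (among them the sketched
edges), the inner edges `some f` of the embedding and the output edge `none`. -/
def network (S : Embedding D VE FE) : TensorNetwork (VD ⊕ VE) (ED ⊕ Option FE) where
  inc
    | Sum.inl e => (D.inc e).disjSum (if h : e ∈ D.sketched then {S.attach ⟨e, h⟩} else ∅)
    | Sum.inr (some f) => (∅ : Finset VD).disjSum (S.ends f)
    | Sum.inr none => {Sum.inr S.out}
  dangling
    | Sum.inl e => D.dangling e && decide (e ∉ D.sketched)
    | Sum.inr (some _) => false
    | Sum.inr none => true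
  size
    | Sum.inl e => D.size e
    | Sum.inr (some f) => S.innerSize f
    | Sum.inr none => S.m
  size_pos := by
    rintro (e | _ | f)
    · exact D.size_pos e
    · exact S.m_pos
    · exact S.innerSize_pos f
  two_ends := by
    rintro (e | _ | f)
    · by_cases h : e ∈ D.sketched
      · simp [h, D.inc_sketched ⟨e, h⟩]
      · simpa [h] using D.two_ends e
    · simp
    · simp [S.ends_card f]

/-- The edge set `E_E` of the embedding inside the overall network. -/
def edges (_S : Embedding D VE FE) : Finset (ED ⊕ Option FE) := D.sketched.disjSum univ

/-- The position of a vertex in the sketching linearization given by an ordering `σ` of the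
embedding vertices: all data vertices are ordered ahead of the embedding vertices. (No embedding
edge connects two data vertices, so that their relative order is immaterial.) -/
def position (σ : VE ≃ Fin (Fintype.card VE)) : VD ⊕ VE → ℕ
  | Sum.inl _ => 0
  | Sum.inr v => (σ v : ℕ) + 1

/-- The edges leaving `A` in the sketching linearization DAG `G_S`: the embedding edges directed
from a vertex in `A` to a later vertex outside of `A`, and the uncontracted ones adjacent to `A`. -/
def edgesOutLin (S : Embedding D VE FE) (σ : VE ≃ Fin (Fintype.card VE))
    (A : Finset (VD ⊕ VE)) : Finset (ED ⊕ Option FE) :=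
  S.edges.filter fun e =>
    (∃ u ∈ S.network.inc e, ∃ v ∈ S.network.inc e,
      u ∈ A ∧ v ∉ A ∧ position σ u < position σ v) ∨
    (S.network.dangling e = true ∧ S.network.inc e ⊆ A)

/-- `cut_{G_S}(A)`. For an embedding vertex `v`, `exp(cut_{G_S}({v}))` is the row size of the
matricization of the tensor at `v`. -/
noncomputable def cutLin (S : Embedding D VE FE) (σ : VE ≃ Fin (Fintype.card VE))
    (A : Finset (VD ⊕ VE)) : ℝ :=
  ∑ e ∈ S.edgesOutLin σ A, S.network.weight e

/-- The embedding is in the class `𝒢^(ε,δ)`, as witnessed by the linearization `σ`, with implied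
constants `κ` (row sizes are `Ω(N_E log(1/δ)/ε²)`) and `κ₁, κ₂` (the output sketch size is
`m = Θ(N_E log(1/δ)/ε²)`), where `N_E` is the number of embedding tensors. -/
def Admissible (S : Embedding D VE FE) (σ : VE ≃ Fin (Fintype.card VE))
    (κ κ₁ κ₂ ε δ : ℝ) : Prop :=
  (∀ v : VE, κ * (Fintype.card VE * Real.log (1 / δ) / ε ^ 2) ≤
    Real.exp (S.cutLin σ {Sum.inr v})) ∧
  κ₁ * (Fintype.card VE * Real.log (1 / δ) / ε ^ 2) ≤ S.m ∧
  S.m ≤ κ₂ * (Fintype.card VE * Real.log (1 / δ) / ε ^ 2)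

/-- `z = a b c d · min(exp(cut_{G_S}(U ∪ V)), m)` for the data contraction `p = (U, V)`. -/
noncomputable def zCost (S : Embedding D VE FE) (σ : VE ≃ Fin (Fintype.card VE))
    (p : Finset VD × Finset VD) : ℝ :=
  D.aSize p * D.bSize p * D.cSize p * D.dSize p *
    min (Real.exp (S.cutLin σ ((p.1 ∪ p.2).disjSum ∅))) S.m

end Embedding

/-!
Every contraction of `T₀` reappears in a tree constrained on `T₀` with the same data edges and some
embedding edges on top, so the task is to bound the weight of the latter. Admissibility says that
each embedding tensor is left by weight at least `log m - O(1)` in the linearization graph, and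
`m < s_j` says the same of the sketched data tensors. A set that contains any of these tensors is
then left by as much, because the edges out of its last tensor all leave the set. One such input
gives the factor `m` of the contractions in `classI`, and two give the factor `m²` in `classS`.

For `t_j`, consider the contraction of `T_B` at which `v_j` first meets an embedding tensor, and let
`P` be its input containing `v_j` if this lies inside `X(e_j)`, and `X(e_j)` otherwise. Attaching
the sketching matrix at `P` turns the part of `T₀` inside `X(e_j)` into a tree whose contractions
are dominated by contractions of `T_B` with an input whose data tensors lie in `X(e_j)`. The sets
`X(e_j)` are disjoint, so each contraction of `T_B` is charged for at most two of them.

For `N m^{5/2}`, the `N` sketched tensors undergo `N - 1` mergers. If a merger `(A, B)` leaves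
weight at most `3/2 log m` going out, then weight about `log m / 2` enters the input that contains
the last tensor, so that input was itself produced at cost `m^{5/2}`; otherwise the weight leaving
`A ∪ B` makes its next contraction cost as much. The potential counts the mergers, corrected for
these two situations.
-/

theorem disjSum_union_disjSum {V W : Type*} [DecidableEq V] [DecidableEq W] (A B : Finset V)
    (C D : Finset W) : A.disjSum C ∪ B.disjSum D = (A ∪ B).disjSum (C ∪ D) := by
  ext (x | x) <;> simp

namespace ContractionTree

section Subtrees

variable {V : Type*}

/-- `s.IsSubtree t`: the tree `s` hangs below some vertex of `t`. -/
inductive IsSubtree : ContractionTree V → ContractionTree V → Prop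
  | refl (t : ContractionTree V) : IsSubtree t t
  | left {s l : ContractionTree V} (r : ContractionTree V) : IsSubtree s l → IsSubtree s (node l r)
  | right {s r : ContractionTree V} (l : ContractionTree V) : IsSubtree s r → IsSubtree s (node l r)

theorem IsSubtree.trans {s t u : ContractionTree V} (hst : s.IsSubtree t) (htu : t.IsSubtree u) :
    s.IsSubtree u := by
  induction htu with
  | refl => exact hst
  | left r _ ih => exact ih.left r
  | right l _ ih => exact ih.right l

variable [DecidableEq V]

theorem verts_nonempty : ∀ T : ContractionTree V, T.verts.Nonempty
  | leaf v => singleton_nonempty v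
  | node l _ => l.verts_nonempty.mono subset_union_left

theorem IsSubtree.verts_subset {s t : ContractionTree V} (h : s.IsSubtree t) :
    s.verts ⊆ t.verts := by
  induction h with
  | refl => exact subset_rfl
  | left r _ ih => exact ih.trans subset_union_left
  | right l _ ih => exact ih.trans subset_union_right

theorem IsSubtree.proper {s t : ContractionTree V} (h : s.IsSubtree t) (ht : t.Proper) :
    s.Proper := by
  induction h with
  | refl => exact ht
  | left r _ ih => exact ih ht.1
  | right l _ ih => exact ih ht.2.1

theorem isSubtree_leaf {T : ContractionTree V} {v : V} (hv : v ∈ T.verts) :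
    (leaf v).IsSubtree T := by
  induction T with
  | leaf w => rw [mem_singleton.1 hv]; exact .refl _
  | node l r hl hr => exact (mem_union.1 hv).elim (fun h => (hl h).left r) fun h => (hr h).right l

theorem mem_contractions_iff {T : ContractionTree V} {p : Finset V × Finset V} :
    p ∈ T.contractions ↔ ∃ l r, (node l r).IsSubtree T ∧ p = (l.verts, r.verts) := by
  induction T with
  | leaf v => simpa only [contractions, notMem_empty, false_iff] using fun ⟨_, _, h, _⟩ => nomatch h
  | node l r hl hr =>
    simp only [contractions, mem_insert, mem_union, hl, hr]
    constructor
    · rintro (h | ⟨l', r', h, hp⟩ | ⟨l', r', h, hp⟩)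
      exacts [⟨l, r, .refl _, h⟩, ⟨l', r', h.left r, hp⟩, ⟨l', r', h.right l, hp⟩]
    · rintro ⟨l', r', h, hp⟩
      cases h with
      | refl => exact .inl hp
      | left _ h => exact .inr (.inl ⟨l', r', h, hp⟩)
      | right _ h => exact .inr (.inr ⟨l', r', h, hp⟩)

theorem IsSubtree.contractions_subset {s t : ContractionTree V} (h : s.IsSubtree t) :
    s.contractions ⊆ t.contractions := fun p hp => by
  obtain ⟨l, r, hs, rfl⟩ := mem_contractions_iff.1 hp
  exact mem_contractions_iff.2 ⟨l, r, hs.trans h, rfl⟩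

theorem fst_nonempty {T : ContractionTree V} {p : Finset V × Finset V}
    (hp : p ∈ T.contractions) : p.1.Nonempty := by
  obtain ⟨l, r, -, rfl⟩ := mem_contractions_iff.1 hp
  exact l.verts_nonempty

theorem snd_nonempty {T : ContractionTree V} {p : Finset V × Finset V}
    (hp : p ∈ T.contractions) : p.2.Nonempty := by
  obtain ⟨l, r, -, rfl⟩ := mem_contractions_iff.1 hp
  exact r.verts_nonempty

theorem union_subset_verts {T : ContractionTree V} {p : Finset V × Finset V}
    (hp : p ∈ T.contractions) : p.1 ∪ p.2 ⊆ T.verts := by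
  obtain ⟨l, r, h, rfl⟩ := mem_contractions_iff.1 hp
  exact h.verts_subset

theorem Proper.disjoint {T : ContractionTree V} (hT : T.Proper) {p : Finset V × Finset V}
    (hp : p ∈ T.contractions) : Disjoint p.1 p.2 := by
  obtain ⟨l, r, h, rfl⟩ := mem_contractions_iff.1 hp
  exact (h.proper hT).2.2

theorem Proper.not_verts_subset_fst {T : ContractionTree V} (hT : T.Proper)
    {p : Finset V × Finset V} (hp : p ∈ T.contractions) : ¬T.verts ⊆ p.1 := fun h => by
  obtain ⟨x, hx⟩ := snd_nonempty hp
  exact disjoint_right.1 (hT.disjoint hp) hx (h (union_subset_verts hp (mem_union_right _ hx)))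

theorem Proper.not_verts_subset_snd {T : ContractionTree V} (hT : T.Proper)
    {p : Finset V × Finset V} (hp : p ∈ T.contractions) : ¬T.verts ⊆ p.2 := fun h => by
  obtain ⟨x, hx⟩ := fst_nonempty hp
  exact disjoint_left.1 (hT.disjoint hp) hx (h (union_subset_verts hp (mem_union_left _ hx)))

theorem Proper.trichotomy {T : ContractionTree V} (hT : T.Proper) {s t : ContractionTree V}
    (hs : s.IsSubtree T) (ht : t.IsSubtree T) :
    s.IsSubtree t ∨ t.IsSubtree s ∨ Disjoint s.verts t.verts := by
  induction hs with
  | refl => exact .inr (.inl ht)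
  | left r hs ih =>
    cases ht with
    | refl => exact .inl (hs.left r)
    | left _ ht => exact ih hT.1 ht
    | right _ ht => exact .inr (.inr (hT.2.2.mono hs.verts_subset ht.verts_subset))
  | right l hs ih =>
    cases ht with
    | refl => exact .inl (hs.right l)
    | left _ ht => exact .inr (.inr (hT.2.2.symm.mono hs.verts_subset ht.verts_subset))
    | right _ ht => exact ih hT.2.1 ht

theorem IsSubtree.eq_of_verts_subset {s t : ContractionTree V} (h : s.IsSubtree t) (ht : t.Proper)
    (hts : t.verts ⊆ s.verts) : s = t := by
  cases h with
  | refl => rfl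
  | left r hs =>
    exact (ht.not_verts_subset_fst (mem_contractions_iff.2 ⟨_, _, .refl _, rfl⟩)
      (hts.trans hs.verts_subset)).elim
  | right l hs =>
    exact (ht.not_verts_subset_snd (mem_contractions_iff.2 ⟨_, _, .refl _, rfl⟩)
      (hts.trans hs.verts_subset)).elim

theorem Proper.isSubtree_of_verts_subset {T : ContractionTree V} (hT : T.Proper)
    {s t : ContractionTree V} (hs : s.IsSubtree T) (ht : t.IsSubtree T)
    (hst : s.verts ⊆ t.verts) : s.IsSubtree t := by
  rcases hT.trichotomy hs ht with h | h | h
  · exact h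
  · rw [h.eq_of_verts_subset (hs.proper hT) hst]
    exact .refl s
  · exact (s.verts_nonempty.ne_empty (disjoint_self.1 (h.mono_right hst))).elim

theorem Proper.contraction_ext {T : ContractionTree V} (hT : T.Proper) {p q : Finset V × Finset V}
    (hp : p ∈ T.contractions) (hq : q ∈ T.contractions) (h : p.1 ∪ p.2 = q.1 ∪ q.2) : p = q := by
  obtain ⟨l, r, hs, rfl⟩ := mem_contractions_iff.1 hp
  obtain ⟨l', r', hs', rfl⟩ := mem_contractions_iff.1 hq
  obtain ⟨rfl, rfl⟩ := node.inj <|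
    (hT.isSubtree_of_verts_subset hs hs' h.subset).eq_of_verts_subset (hs'.proper hT) h.superset
  rfl

theorem Proper.contraction_cases {T : ContractionTree V} (hT : T.Proper) {s : ContractionTree V}
    (hs : s.IsSubtree T) {p : Finset V × Finset V} (hp : p ∈ T.contractions) :
    p.1 ∪ p.2 ⊆ s.verts ∨ s.verts ⊆ p.1 ∨ s.verts ⊆ p.2 ∨ Disjoint s.verts (p.1 ∪ p.2) := by
  obtain ⟨l, r, hn, rfl⟩ := mem_contractions_iff.1 hp
  rcases hT.trichotomy hs hn with h | h | h
  · cases h with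
    | refl => exact .inl subset_rfl
    | left _ h => exact .inr (.inl h.verts_subset)
    | right _ h => exact .inr (.inr (.inl h.verts_subset))
  · exact .inl h.verts_subset
  · exact .inr (.inr (.inr h))

theorem Proper.contractions_eq_filter {T : ContractionTree V} (hT : T.Proper)
    {s : ContractionTree V} (hs : s.IsSubtree T) :
    s.contractions = T.contractions.filter fun p => p.1 ∪ p.2 ⊆ s.verts := by
  ext p
  refine ⟨fun hp => mem_filter.2 ⟨hs.contractions_subset hp, union_subset_verts hp⟩, fun hp => ?_⟩
  obtain ⟨hpT, hps⟩ := mem_filter.1 hp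
  obtain ⟨l, r, hn, rfl⟩ := mem_contractions_iff.1 hpT
  exact mem_contractions_iff.2 ⟨l, r, hT.isSubtree_of_verts_subset hn hs hps, rfl⟩

theorem Proper.sum_contractions_node {M : Type*} [AddCommMonoid M] {l r : ContractionTree V}
    (hT : (node l r).Proper) (f : Finset V × Finset V → M) :
    ∑ p ∈ (node l r).contractions, f p =
      f (l.verts, r.verts) + (∑ p ∈ l.contractions, f p + ∑ p ∈ r.contractions, f p) := by
  have hmem : (l.verts, r.verts) ∈ (node l r).contractions := mem_insert_self _ _
  rw [contractions, sum_insert, sum_union]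
  · refine disjoint_left.2 fun p hl hr => ?_
    obtain ⟨x, hx⟩ := fst_nonempty hl
    exact disjoint_left.1 hT.2.2 (union_subset_verts hl (mem_union_left _ hx))
      (union_subset_verts hr (mem_union_left _ hx))
  · rw [mem_union]
    rintro (h | h)
    · exact hT.not_verts_subset_fst hmem (union_subset_verts h)
    · exact hT.not_verts_subset_snd hmem (union_subset_verts h)

/-- `T` contracts `A` with `B`, in either order of the two inputs. -/
def Contracts (T : ContractionTree V) (A B : Finset V) : Prop :=
  (A, B) ∈ T.contractions ∨ (B, A) ∈ T.contractions

namespace Contracts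

variable {T : ContractionTree V} {A B : Finset V}

theorem symm (h : T.Contracts A B) : T.Contracts B A := Or.symm h

theorem disjoint (h : T.Contracts A B) (hT : T.Proper) : Disjoint A B :=
  h.elim (fun h => hT.disjoint h) fun h => (hT.disjoint h).symm

theorem left_nonempty (h : T.Contracts A B) : A.Nonempty :=
  h.elim (fun h => fst_nonempty h) fun h => snd_nonempty h

theorem union_subset (h : T.Contracts A B) : A ∪ B ⊆ T.verts :=
  h.elim (fun h => union_subset_verts h) fun h => union_comm A B ▸ union_subset_verts h

theorem of_isSubtree {s : ContractionTree V} (h : s.Contracts A B) (hs : s.IsSubtree T) :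
    T.Contracts A B :=
  h.imp (fun h => hs.contractions_subset h) fun h => hs.contractions_subset h

theorem exists_isSubtree_left (h : T.Contracts A B) :
    ∃ s : ContractionTree V, s.IsSubtree T ∧ s.verts = A := by
  rcases h with h | h <;> obtain ⟨l, r, hs, he⟩ := mem_contractions_iff.1 h <;>
    obtain ⟨rfl, rfl⟩ := Prod.ext_iff.1 he
  exacts [⟨l, .trans (.left r (.refl l)) hs, rfl⟩, ⟨r, .trans (.right l (.refl r)) hs, rfl⟩]

theorem cases (h : T.Contracts A B) (hT : T.Proper) {s : ContractionTree V} (hs : s.IsSubtree T) :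
    A ∪ B ⊆ s.verts ∨ s.verts ⊆ A ∨ s.verts ⊆ B ∨ Disjoint s.verts (A ∪ B) := by
  rcases h with h | h
  · exact hT.contraction_cases hs h
  · have := hT.contraction_cases hs h
    rw [union_comm B A] at this
    tauto

end Contracts

theorem IsSubtree.exists_parent {s t : ContractionTree V} (h : s.IsSubtree t) (hne : s ≠ t) :
    ∃ B, t.Contracts s.verts B := by
  induction h with
  | refl => exact (hne rfl).elim
  | @left l r _ ih =>
    by_cases hl : s = l
    · exact ⟨r.verts, .inl (hl ▸ mem_insert_self _ _)⟩
    · have ⟨B, hB⟩ := ih hl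
      exact ⟨B, hB.of_isSubtree (.left r (.refl l))⟩
  | @right r l _ ih =>
    by_cases hr : s = r
    · exact ⟨l.verts, .inr (hr ▸ mem_insert_self _ _)⟩
    · have ⟨B, hB⟩ := ih hr
      exact ⟨B, hB.of_isSubtree (.right l (.refl r))⟩

end Subtrees

section Touching

variable {V W : Type*} [DecidableEq V] [DecidableEq W]

/-- The contractions of `T` with an input that contains at least one data tensor and no data tensor
outside `X`; the cost of sketching `X` is charged to these. -/
def touching (T : ContractionTree (V ⊕ W)) (X : Finset V) :
    Finset (Finset (V ⊕ W) × Finset (V ⊕ W)) :=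
  T.contractions.filter fun q =>
    (q.1.toLeft.Nonempty ∧ q.1.toLeft ⊆ X) ∨ (q.2.toLeft.Nonempty ∧ q.2.toLeft ⊆ X)

theorem sum_touching_le {ι : Type*} [Fintype ι] (T : ContractionTree (V ⊕ W)) {X : ι → Finset V}
    (hX : Pairwise (Function.onFun Disjoint X)) {f : Finset (V ⊕ W) × Finset (V ⊕ W) → ℝ}
    (hf : ∀ q, 0 ≤ f q) : ∑ i, ∑ q ∈ T.touching (X i), f q ≤ 2 * ∑ q ∈ T.contractions, f q := by
  classical
  have hcard (A : Finset V) : #{i | A.Nonempty ∧ A ⊆ X i} ≤ 1 := by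
    refine card_le_one.2 fun i hi j hj => by_contra fun hij => ?_
    obtain ⟨-, ⟨x, hx⟩, hi⟩ := mem_filter.1 hi
    exact disjoint_left.1 (hX hij) (hi hx) ((mem_filter.1 hj).2.2 hx)
  simp only [touching, sum_filter]
  rw [sum_comm, mul_sum]
  refine sum_le_sum fun q _ => ?_
  rw [← sum_filter, sum_const, nsmul_eq_mul, filter_or]
  refine mul_le_mul_of_nonneg_right ?_ (hf q)
  exact_mod_cast (card_union_le _ _).trans (add_le_add (hcard q.1.toLeft) (hcard q.2.toLeft))

theorem Contracts.le_sum_touching {T : ContractionTree (V ⊕ W)} {A B : Finset (V ⊕ W)}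
    (h : T.Contracts A B) (hA : A.toLeft.Nonempty) {X : Finset V} (hAX : A.toLeft ⊆ X)
    {f : Finset (V ⊕ W) → Finset (V ⊕ W) → ℝ} (hsymm : ∀ A B, f A B = f B A)
    (hf : ∀ A B, 0 ≤ f A B) : f A B ≤ ∑ q ∈ T.touching X, f q.1 q.2 := by
  rcases h with h | h
  · exact single_le_sum (f := fun q : _ × _ => f q.1 q.2) (fun _ _ => hf _ _)
      (mem_filter.2 ⟨h, .inl ⟨hA, hAX⟩⟩)
  · rw [hsymm]
    exact single_le_sum (f := fun q : _ × _ => f q.1 q.2) (fun _ _ => hf _ _)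
      (mem_filter.2 ⟨h, .inr ⟨hA, hAX⟩⟩)

end Touching

section Attach

variable {V : Type*}

/-- The tree `T` on the left summand of a larger vertex type. -/
def lift (W : Type*) : ContractionTree V → ContractionTree (V ⊕ W)
  | leaf v => leaf (Sum.inl v)
  | node l r => node (lift W l) (lift W r)

variable [DecidableEq V]

theorem verts_lift {W : Type*} [DecidableEq W] (T : ContractionTree V) :
    (T.lift W).verts = T.verts.disjSum ∅ := by
  induction T with
  | leaf v => simp [lift, verts]
  | node l r hl hr => rw [lift, verts, hl, hr, verts, disjSum_union_disjSum, union_empty]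

theorem disjoint_verts_lift {W : Type*} [DecidableEq W] (T : ContractionTree V) {A : Finset V}
    (h : Disjoint T.verts A) (C : Finset W) : Disjoint (T.lift W).verts (A.disjSum C) := by
  rw [verts_lift, disjoint_left] at *
  rintro (x | x)
  · simpa only [inl_mem_disjSum] using @h x
  · simp only [inr_mem_disjSum, notMem_empty, false_implies]

theorem Proper.lift {W : Type*} [DecidableEq W] {T : ContractionTree V} (hT : T.Proper) :
    (T.lift W).Proper := by
  induction T with
  | leaf v => trivial
  | node l r hl hr =>
    refine ⟨hl hT.1, hr hT.2.1, ?_⟩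
    rw [verts_lift r]
    exact disjoint_verts_lift l hT.2.2 ∅

theorem contractions_lift {W : Type*} [DecidableEq W] (T : ContractionTree V) :
    (T.lift W).contractions = T.contractions.image fun p => (p.1.disjSum ∅, p.2.disjSum ∅) := by
  induction T with
  | leaf v => rfl
  | node l r hl hr =>
    rw [lift, contractions, hl, hr, contractions, image_insert, image_union, verts_lift, verts_lift]

/-- The tensors below an inner vertex after a further tensor `inr ()` has been attached at `P`:
the new tensor takes part in every contraction above `P`. -/
def extend (P A : Finset V) : Finset (V ⊕ Unit) := A.disjSum (if P ⊆ A then {()} else ∅)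

theorem toLeft_extend (P A : Finset V) : (extend P A).toLeft = A := toLeft_disjSum

theorem inl_mem_extend {P A : Finset V} {v : V} : Sum.inl v ∈ extend P A ↔ v ∈ A :=
  inl_mem_disjSum

theorem inr_mem_extend {P A : Finset V} : Sum.inr () ∈ extend P A ↔ P ⊆ A := by
  rw [extend, inr_mem_disjSum]
  split_ifs with h <;> simp [h]

theorem disjoint_extend {P A B : Finset V} (hP : P.Nonempty) (h : Disjoint A B) :
    Disjoint (extend P A) (extend P B) := by
  obtain ⟨x, hx⟩ := hP
  refine disjoint_left.2 ?_
  rintro (v | u) hA hB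
  · exact disjoint_left.1 h (inl_mem_extend.1 hA) (inl_mem_extend.1 hB)
  · exact disjoint_left.1 h (inr_mem_extend.1 hA hx) (inr_mem_extend.1 hB hx)

theorem contractions_lift_eq_extend {T : ContractionTree V} {P : Finset V}
    (h : ∀ p ∈ T.contractions, ¬P ⊆ p.1 ∧ ¬P ⊆ p.2) :
    (T.lift Unit).contractions = T.contractions.image (Prod.map (extend P) (extend P)) := by
  rw [contractions_lift]
  refine image_congr fun p hp => ?_
  simp only [Prod.map, extend, if_neg (h p hp).1, if_neg (h p hp).2]

theorem contractions_lift_of_disjoint {s t : ContractionTree V} (h : Disjoint s.verts t.verts) :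
    (t.lift Unit).contractions =
      t.contractions.image (Prod.map (extend s.verts) (extend s.verts)) := by
  have hs : ∀ A ⊆ t.verts, ¬s.verts ⊆ A := fun A hA hsA =>
    s.verts_nonempty.ne_empty (disjoint_self.1 (h.mono_right (hsA.trans hA)))
  refine contractions_lift_eq_extend fun p hp => ?_
  have hpt := union_subset_iff.1 (union_subset_verts hp)
  exact ⟨hs _ hpt.1, hs _ hpt.2⟩

theorem extend_of_disjoint {s t : ContractionTree V} (h : Disjoint s.verts t.verts) :
    extend s.verts t.verts = (t.lift Unit).verts := by
  rw [extend, verts_lift, if_neg]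
  exact fun hst => s.verts_nonempty.ne_empty (disjoint_self.1 (h.mono_right hst))

theorem IsSubtree.exists_attach {s T : ContractionTree V} (hs : s.IsSubtree T) (hT : T.Proper) :
    ∃ T' : ContractionTree (V ⊕ Unit), T'.IsTreeOf (T.verts.disjSum {()}) ∧
      T'.contractions = insert (s.verts.disjSum ∅, {Sum.inr ()})
        (T.contractions.image (Prod.map (extend s.verts) (extend s.verts))) := by
  induction hs with
  | refl =>
    refine ⟨node (s.lift Unit) (leaf (Sum.inr ())), ⟨⟨hT.lift, trivial, ?_⟩, ?_⟩, ?_⟩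
    · simp [verts_lift, verts]
    · rw [verts, verts_lift, verts]
      ext (x | x) <;> simp
    · rw [contractions, verts_lift, verts, contractions, union_empty,
        contractions_lift_eq_extend fun p hp =>
          ⟨hT.not_verts_subset_fst hp, hT.not_verts_subset_snd hp⟩]
  | @left l r hs ih =>
    obtain ⟨t, ⟨ht, htv⟩, htc⟩ := ih hT.1
    have hsr := hT.2.2.mono_left hs.verts_subset
    refine ⟨node t (r.lift Unit), ⟨⟨ht, hT.2.1.lift, ?_⟩, ?_⟩, ?_⟩
    · exact htv ▸ (disjoint_verts_lift r hT.2.2.symm _).symm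
    · rw [verts, htv, verts_lift, disjSum_union_disjSum, union_empty, verts]
    · rw [contractions, htv, htc, contractions_lift_of_disjoint hsr, contractions, image_insert,
        image_union, insert_union, Finset.insert_comm, Prod.map, extend_of_disjoint hsr, extend,
        if_pos hs.verts_subset]
  | @right r l hs ih =>
    obtain ⟨t, ⟨ht, htv⟩, htc⟩ := ih hT.2.1
    have hsl := hT.2.2.symm.mono_left hs.verts_subset
    refine ⟨node (l.lift Unit) t, ⟨⟨hT.1.lift, ht, ?_⟩, ?_⟩, ?_⟩
    · exact htv ▸ disjoint_verts_lift l hT.2.2 _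
    · rw [verts, htv, verts_lift, disjSum_union_disjSum, empty_union, verts]
    · rw [contractions, htv, htc, contractions_lift_of_disjoint hsl, contractions, image_insert,
        image_union, union_insert, Finset.insert_comm, Prod.map, extend_of_disjoint hsl, extend,
        if_pos hs.verts_subset]

end Attach

section Constrained

variable {V W : Type*} [DecidableEq V] [DecidableEq W] {T : ContractionTree (V ⊕ W)}

theorem RespectsContractions.exists_contracts {C : Finset (Finset V × Finset V)}
    (hT : T.RespectsContractions C) {p : Finset V × Finset V} (hp : p ∈ C) :
    ∃ A B, T.Contracts A B ∧ A.toLeft = p.1 ∧ B.toLeft = p.2 := by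
  obtain ⟨q, hq, h | h⟩ := hT p hp
  exacts [⟨q.1, q.2, .inl hq, h⟩, ⟨q.2, q.1, .inr hq, h.symm⟩]

theorem ConstrainedOn.exists_contracts {T₀ : ContractionTree V} (hT : T.ConstrainedOn T₀)
    {X Z : Finset V} (h : T₀.Contracts X Z) :
    ∃ A B, T.Contracts A B ∧ A.toLeft = X ∧ B.toLeft = Z := by
  rcases h with h | h
  · exact RespectsContractions.exists_contracts hT h
  · obtain ⟨A, B, hAB, hA, hB⟩ := RespectsContractions.exists_contracts hT h
    exact ⟨B, A, hAB.symm, hB, hA⟩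

theorem Proper.exists_isSubtree_toLeft (hT : T.Proper) {T₀ : ContractionTree V}
    (hc : T.ConstrainedOn T₀) {s : ContractionTree (V ⊕ W)} (hs : s.IsSubtree T)
    (hne : s.verts.toLeft.Nonempty) (hsub : s.verts.toLeft ⊆ T₀.verts) :
    ∃ t : ContractionTree V, t.IsSubtree T₀ ∧ t.verts = s.verts.toLeft := by
  induction T₀ with
  | leaf v => exact ⟨leaf v, .refl _, (hne.subset_singleton_iff.1 hsub).symm⟩
  | node l r hl hr =>
    by_cases hsl : s.verts.toLeft ⊆ l.verts
    · obtain ⟨t, ht, hts⟩ := hl (fun p hp => hc p (by simp [contractions, hp])) hsl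
      exact ⟨t, ht.left r, hts⟩
    by_cases hsr : s.verts.toLeft ⊆ r.verts
    · obtain ⟨t, ht, hts⟩ := hr (fun p hp => hc p (by simp [contractions, hp])) hsr
      exact ⟨t, ht.right l, hts⟩
    refine ⟨node l r, .refl _, subset_antisymm ?_ hsub⟩
    obtain ⟨A, B, hAB, hA, hB⟩ :=
      hc.exists_contracts (X := l.verts) (Z := r.verts) (.inl (mem_insert_self _ _))
    have hunion : (A ∪ B).toLeft = l.verts ∪ r.verts := by rw [toLeft_union, hA, hB]
    rcases hAB.cases hT hs with h | h | h | h
    · exact hunion.superset.trans (toLeft_subset_toLeft h)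
    · exact (hsl ((toLeft_subset_toLeft h).trans hA.subset)).elim
    · exact (hsr ((toLeft_subset_toLeft h).trans hB.subset)).elim
    · obtain ⟨x, hx⟩ := hne
      have hxAB : x ∈ (A ∪ B).toLeft := hunion ▸ hsub hx
      exact (disjoint_left.1 h (mem_toLeft.1 hx) (mem_toLeft.1 hxAB)).elim

theorem Contracts.union_subset_of_toLeft_subset {A B : Finset (V ⊕ W)} (h : T.Contracts A B)
    (hT : T.Proper) {s : ContractionTree (V ⊕ W)} (hs : s.IsSubtree T) (hA : A.toLeft.Nonempty)
    (hB : B.toLeft.Nonempty) (hAB : A.toLeft ∪ B.toLeft ⊆ s.verts.toLeft) : A ∪ B ⊆ s.verts := by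
  obtain ⟨x, hx⟩ := hA
  obtain ⟨y, hy⟩ := hB
  have hxs := mem_toLeft.1 (hAB (mem_union_left _ hx))
  have hys := mem_toLeft.1 (hAB (mem_union_right _ hy))
  rw [mem_toLeft] at hx hy
  rcases h.cases hT hs with hsub | hsub | hsub | hdisj
  · exact hsub
  · exact (disjoint_left.1 (h.disjoint hT) (hsub hys) hy).elim
  · exact (disjoint_left.1 (h.disjoint hT) hx (hsub hxs)).elim
  · exact (disjoint_left.1 hdisj hxs (mem_union_left _ hx)).elim

theorem exists_first_mixed_contraction {v : V} {w : W} (hv : Sum.inl v ∈ T.verts)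
    (hw : Sum.inr w ∈ T.verts) :
    ∃ A B, T.Contracts A B ∧ Sum.inl v ∈ A ∧ A.toRight = ∅ ∧ B.toRight.Nonempty := by
  induction T generalizing w with
  | leaf x => exact (Sum.inl_ne_inr ((mem_singleton.1 hv).trans (mem_singleton.1 hw).symm)).elim
  | node l r hl hr =>
    have hroot : (node l r).Contracts l.verts r.verts := .inl (mem_insert_self _ _)
    have hsplit : w ∈ l.verts.toRight ∨ w ∈ r.verts.toRight := by simpa [verts] using hw
    rcases mem_union.1 hv with hv | hv
    · rcases l.verts.toRight.eq_empty_or_nonempty with h | ⟨w', h⟩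
      · exact ⟨_, _, hroot, hv, h, w, hsplit.resolve_left (h ▸ notMem_empty w)⟩
      · obtain ⟨A, B, hAB, hA⟩ := hl hv (mem_toRight.1 h)
        exact ⟨A, B, hAB.of_isSubtree (.left r (.refl l)), hA⟩
    · rcases r.verts.toRight.eq_empty_or_nonempty with h | ⟨w', h⟩
      · exact ⟨_, _, hroot.symm, hv, h, w, hsplit.resolve_right (h ▸ notMem_empty w)⟩
      · obtain ⟨A, B, hAB, hA⟩ := hr hv (mem_toRight.1 h)
        exact ⟨A, B, hAB.of_isSubtree (.right l (.refl r)), hA⟩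

/-- Distinct contractions of `T₀` are matched by distinct contractions of `T`, since a contraction
is determined by its output. -/
theorem RespectsContractions.sum_le_sum_of_forall_contracts_le {T₀ : ContractionTree V}
    (hT₀ : T₀.Proper) {C : Finset (Finset V × Finset V)} (hC : C ⊆ T₀.contractions)
    (hT : T.RespectsContractions C)
    {R : Finset (Finset (V ⊕ W) × Finset (V ⊕ W))} {F : Finset V × Finset V → ℝ}
    {f : Finset (V ⊕ W) → Finset (V ⊕ W) → ℝ} (hsymm : ∀ A B, f A B = f B A) (hf : ∀ A B, 0 ≤ f A B)
    (hR : ∀ p ∈ C, ∀ q ∈ T.contractions, q.1.toLeft ∪ q.2.toLeft = p.1 ∪ p.2 → q ∈ R)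
    (hF : ∀ p ∈ C, ∀ A B, T.Contracts A B → A.toLeft = p.1 → B.toLeft = p.2 → F p ≤ f A B) :
    ∑ p ∈ C, F p ≤ ∑ q ∈ R, f q.1 q.2 := by
  have hmatch : ∀ p : C, ∃ q ∈ T.contractions, q.1.toLeft ∪ q.2.toLeft = p.1.1 ∪ p.1.2 ∧
      F p ≤ f q.1 q.2 := fun p => by
    obtain ⟨A, B, h | h, hA, hB⟩ := hT.exists_contracts p.2
    · exact ⟨_, h, by rw [hA, hB], hF p p.2 A B (.inl h) hA hB⟩
    · exact ⟨_, h, by rw [hA, hB, union_comm], hsymm A B ▸ hF p p.2 A B (.inr h) hA hB⟩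
  choose q hqT hqp hqF using hmatch
  have hinj : Set.InjOn q (C.attach : Set C) := fun p _ p' _ h =>
    Subtype.ext (hT₀.contraction_ext (hC p.2) (hC p'.2) (by rw [← hqp, ← hqp, h]))
  calc ∑ p ∈ C, F p = ∑ p ∈ C.attach, F p := (sum_attach C F).symm
    _ ≤ ∑ p ∈ C.attach, f (q p).1 (q p).2 := sum_le_sum fun p _ => hqF p
    _ = ∑ r ∈ C.attach.image q, f r.1 r.2 := by rw [sum_image hinj]
    _ ≤ ∑ r ∈ R, f r.1 r.2 := by
      refine sum_le_sum_of_subset_of_nonneg (image_subset_iff.2 fun p _ => ?_) fun r _ _ => hf _ _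
      exact hR p p.2 _ (hqT p) (hqp p)

end Constrained

end ContractionTree

namespace TensorNetwork

section Edges

variable {V E : Type*} (G : TensorNetwork V E)

theorem inc_nonempty (e : E) : (G.inc e).Nonempty := by
  have h := G.two_ends e
  have := Bool.toNat_le (G.dangling e)
  exact card_pos.1 (by omega)

theorem weight_nonneg (e : E) : 0 ≤ G.weight e :=
  Real.log_nonneg (by exact_mod_cast G.size_pos e)

theorem sum_weight_mono {s t : Finset E} (h : s ⊆ t) :
    ∑ e ∈ s, G.weight e ≤ ∑ e ∈ t, G.weight e :=
  sum_le_sum_of_subset_of_nonneg h fun e _ _ => G.weight_nonneg e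

theorem sum_weight_union_le [DecidableEq E] (s t : Finset E) :
    ∑ e ∈ s ∪ t, G.weight e ≤ ∑ e ∈ s, G.weight e + ∑ e ∈ t, G.weight e := by
  rw [← sum_union_inter]
  exact le_add_of_nonneg_right (sum_nonneg fun e _ => G.weight_nonneg e)

end Edges

section Cuts

variable {V E : Type*} [Fintype V] [DecidableEq V] [Fintype E] [DecidableEq E]
  {G : TensorNetwork V E} {A B : Finset V} {e : E}

theorem mem_edgesOut : e ∈ G.edgesOut A ↔
    (∃ v ∈ G.inc e, v ∈ A) ∧ (G.dangling e = true ∨ ∃ v ∈ G.inc e, v ∉ A) := by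
  simp only [edgesOut, edgesBetween, edgesDangling, mem_union, mem_filter, mem_univ, true_and,
    mem_sdiff]
  obtain ⟨v, hv⟩ := G.inc_nonempty e
  constructor
  · rintro (⟨h, h'⟩ | ⟨h, h'⟩)
    exacts [⟨h, .inr h'⟩, ⟨⟨v, hv, h' hv⟩, .inl h⟩]
  · rintro ⟨h, h' | h'⟩
    · by_cases hA : G.inc e ⊆ A
      exacts [.inr ⟨h', hA⟩, .inl ⟨h, not_subset.1 hA⟩]
    · exact .inl ⟨h, h'⟩

theorem edgesOut_empty : G.edgesOut ∅ = ∅ := by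
  ext e
  simp [mem_edgesOut]

theorem edgesBetween_eq_inter (h : Disjoint A B) :
    G.edgesBetween A B = G.edgesOut A ∩ G.edgesOut B := by
  ext e
  simp only [mem_inter, edgesBetween, mem_filter, mem_univ, true_and]
  constructor
  · rintro ⟨⟨v, hv, hvA⟩, ⟨w, hw, hwB⟩⟩
    exact ⟨mem_edgesOut.2 ⟨⟨v, hv, hvA⟩, .inr ⟨w, hw, disjoint_right.1 h hwB⟩⟩,
      mem_edgesOut.2 ⟨⟨w, hw, hwB⟩, .inr ⟨v, hv, disjoint_left.1 h hvA⟩⟩⟩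
  · exact fun ⟨hA, hB⟩ => ⟨(mem_edgesOut.1 hA).1, (mem_edgesOut.1 hB).1⟩

theorem logCost_eq_sum (h : Disjoint A B) :
    G.logCost A B = ∑ e ∈ G.edgesOut A ∪ G.edgesOut B, G.weight e := by
  rw [logCost, cut, cut, cutBetween, edgesBetween_eq_inter h, ← sum_union_inter,
    add_sub_cancel_right]

theorem cut_le_logCost (h : Disjoint A B) : G.cut A ≤ G.logCost A B := by
  rw [logCost_eq_sum h]
  exact G.sum_weight_mono subset_union_left

theorem logCost_empty (A : Finset V) : G.logCost A ∅ = G.cut A := by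
  rw [logCost_eq_sum (disjoint_empty_right A), edgesOut_empty, union_empty, cut]

theorem logCost_comm (A B : Finset V) : G.logCost A B = G.logCost B A := by
  simp only [logCost, cutBetween, edgesBetween, and_comm, add_comm]

theorem restrict_logCost (F : Finset E) (h : Disjoint A B) :
    (G.restrict F).logCost A B = ∑ e ∈ F ∩ (G.edgesOut A ∪ G.edgesOut B), G.weight e := by
  have hedges : (G.restrict F).edgesOut A ∪ (G.restrict F).edgesOut B =
      (G.edgesOut A ∪ G.edgesOut B).subtype (· ∈ F) := by
    ext e
    simp only [mem_union, mem_subtype, mem_edgesOut, restrict]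
  rw [logCost_eq_sum h, hedges, inter_comm, ← filter_mem_eq_inter]
  exact sum_subtype_eq_sum_filter G.weight

end Cuts

/-- An ordering of the ends of the hyperedges in `edges`, all of which lie in `verts`. It directs
each of these hyperedges away from its end of least position, so that a data tensor of position `0`
is never entered. -/
structure Linearization {V E : Type*} (G : TensorNetwork V E) where
  edges : Finset E
  verts : Finset V
  pos : V → ℕ
  inc_subset : ∀ e ∈ edges, G.inc e ⊆ verts
  injOn : ∀ e ∈ edges, Set.InjOn pos (G.inc e)

namespace Linearization

section Source

variable {V E : Type*} {G : TensorNetwork V E} (L : Linearization G)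

/-- The end of a hyperedge from which it is directed. -/
noncomputable def src (e : E) : V := (exists_min_image (G.inc e) L.pos (G.inc_nonempty e)).choose

theorem src_mem (e : E) : L.src e ∈ G.inc e :=
  (exists_min_image (G.inc e) L.pos (G.inc_nonempty e)).choose_spec.1

theorem pos_src_le {e : E} {v : V} (hv : v ∈ G.inc e) : L.pos (L.src e) ≤ L.pos v :=
  (exists_min_image (G.inc e) L.pos (G.inc_nonempty e)).choose_spec.2 v hv

variable {L} in
theorem pos_src_lt {e : E} (he : e ∈ L.edges) {v : V} (hv : v ∈ G.inc e) (hne : v ≠ L.src e) :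
    L.pos (L.src e) < L.pos v :=
  (L.pos_src_le hv).lt_of_ne fun h => hne (L.injOn e he hv (L.src_mem e) h.symm)

end Source

section Sources

variable {V E : Type*} [DecidableEq V] {G : TensorNetwork V E} (L : Linearization G)

/-- The vertices of `A` in position zero. -/
def sources (A : Finset V) : Finset V := {v ∈ A ∩ L.verts | L.pos v = 0}

variable {L} {A B : Finset V}

theorem inter_verts_congr (h : A ∩ L.verts = B ∩ L.verts) {v : V} (hv : v ∈ L.verts) :
    v ∈ A ↔ v ∈ B := by
  simpa [hv] using Finset.ext_iff.1 h v

theorem card_sources_union (h : Disjoint A B) :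
    #(L.sources (A ∪ B)) = #(L.sources A) + #(L.sources B) := by
  rw [sources, union_inter_distrib_right, filter_union, card_union_of_disjoint]
  · rfl
  · exact h.mono ((filter_subset _ _).trans inter_subset_left)
      ((filter_subset _ _).trans inter_subset_left)

end Sources

section Weights

variable {V E : Type*} [DecidableEq V] [Fintype V] [DecidableEq E] [Fintype E]
  {G : TensorNetwork V E} (L : Linearization G) {A B : Finset V}

/-- The directed hyperedges out of `A`. -/
noncomputable def leaving (A : Finset V) : Finset E :=
  {e ∈ L.edges ∩ G.edgesOut A | L.src e ∈ A}

/-- The directed hyperedges into `A` from outside. -/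
noncomputable def entering (A : Finset V) : Finset E :=
  {e ∈ L.edges ∩ G.edgesOut A | L.src e ∉ A}

/-- The total weight of the directed hyperedges out of `A`, the paper's `cut` in the linearization
graph. -/
noncomputable def outWeight (A : Finset V) : ℝ := ∑ e ∈ L.leaving A, G.weight e

/-- The total weight of the directed hyperedges into `A`. -/
noncomputable def inWeight (A : Finset V) : ℝ := ∑ e ∈ L.entering A, G.weight e

/-- The weight that the directed hyperedges contribute to the contraction of `A` with `B`. -/
noncomputable def contractionWeight (A B : Finset V) : ℝ :=
  L.outWeight A + L.outWeight B + L.inWeight (A ∪ B)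

/-- Each single vertex of the linearization is left by a weight of at least `a`. -/
def HasMinOutWeight (a : ℝ) : Prop := ∀ v ∈ L.verts, a ≤ L.outWeight {v}

theorem outWeight_nonneg (A : Finset V) : 0 ≤ L.outWeight A :=
  sum_nonneg fun e _ => G.weight_nonneg e

theorem inWeight_nonneg (A : Finset V) : 0 ≤ L.inWeight A :=
  sum_nonneg fun e _ => G.weight_nonneg e

variable {L}

theorem mem_leaving {e : E} : e ∈ L.leaving A ↔
    e ∈ L.edges ∧ L.src e ∈ A ∧ (G.dangling e = true ∨ ∃ v ∈ G.inc e, v ∉ A) := by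
  rw [leaving, mem_filter, mem_inter, mem_edgesOut]
  exact ⟨fun ⟨⟨he, _, h⟩, hs⟩ => ⟨he, hs, h⟩,
    fun ⟨he, hs, h⟩ => ⟨⟨he, ⟨_, L.src_mem e, hs⟩, h⟩, hs⟩⟩

theorem mem_entering {e : E} : e ∈ L.entering A ↔
    e ∈ L.edges ∧ L.src e ∉ A ∧ ∃ v ∈ G.inc e, v ∈ A := by
  rw [entering, mem_filter, mem_inter, mem_edgesOut]
  exact ⟨fun ⟨⟨he, h, _⟩, hs⟩ => ⟨he, hs, h⟩,
    fun ⟨he, hs, h⟩ => ⟨⟨he, h, .inr ⟨_, L.src_mem e, hs⟩⟩, hs⟩⟩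

theorem outWeight_congr (h : A ∩ L.verts = B ∩ L.verts) : L.outWeight A = L.outWeight B := by
  refine sum_congr (Finset.ext fun e => ?_) fun _ _ => rfl
  rw [mem_leaving, mem_leaving]
  refine and_congr_right fun he => and_congr
    (inter_verts_congr h (L.inc_subset e he (L.src_mem e))) (or_congr_right ?_)
  exact exists_congr fun v => and_congr_right fun hv =>
    not_congr (inter_verts_congr h (L.inc_subset e he hv))

theorem inWeight_congr (h : A ∩ L.verts = B ∩ L.verts) : L.inWeight A = L.inWeight B := by
  refine sum_congr (Finset.ext fun e => ?_) fun _ _ => rfl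
  rw [mem_entering, mem_entering]
  refine and_congr_right fun he => and_congr
    (not_congr (inter_verts_congr h (L.inc_subset e he (L.src_mem e)))) ?_
  exact exists_congr fun v => and_congr_right fun hv =>
    inter_verts_congr h (L.inc_subset e he hv)

theorem outWeight_eq_zero (h : A ∩ L.verts = ∅) : L.outWeight A = 0 := by
  rw [outWeight_congr (h.trans (empty_inter _).symm), outWeight, leaving, edgesOut_empty,
    inter_empty, filter_empty, sum_empty]

theorem contractionWeight_le_sum (h : Disjoint A B) :
    L.contractionWeight A B ≤ ∑ e ∈ L.edges ∩ (G.edgesOut A ∪ G.edgesOut B), G.weight e := by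
  have hout : Disjoint (L.leaving A) (L.leaving B) := disjoint_left.2 fun e hA hB =>
    disjoint_left.1 h (mem_leaving.1 hA).2.1 (mem_leaving.1 hB).2.1
  have hin : Disjoint (L.leaving A ∪ L.leaving B) (L.entering (A ∪ B)) :=
    disjoint_left.2 fun e hout hin => (mem_entering.1 hin).2.1 <| mem_union.2 <|
      (mem_union.1 hout).imp (fun h => (mem_leaving.1 h).2.1) fun h => (mem_leaving.1 h).2.1
  rw [contractionWeight, outWeight, outWeight, inWeight, ← sum_union hout, ← sum_union hin]
  refine G.sum_weight_mono fun e he => ?_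
  simp only [mem_union, mem_leaving, mem_entering, mem_inter, mem_edgesOut] at he ⊢
  have := L.src_mem e
  grind

/-- The hyperedges directed out of a last vertex of a set have no later end within the set. -/
theorem leaving_singleton_subset {v : V} (hv : v ∈ A)
    (hmax : ∀ u ∈ A ∩ L.verts, L.pos u ≤ L.pos v) : L.leaving {v} ⊆ L.leaving A := by
  intro e he
  simp only [mem_leaving, mem_singleton] at he ⊢
  obtain ⟨he, rfl, hout⟩ := he
  refine ⟨he, hv, hout.imp_right fun ⟨u, hu, hne⟩ => ⟨u, hu, fun huA => ?_⟩⟩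
  exact (pos_src_lt he hu hne).not_ge (hmax u (mem_inter.2 ⟨huA, L.inc_subset e he hu⟩))

theorem HasMinOutWeight.le_outWeight {a : ℝ} (ha : L.HasMinOutWeight a)
    (hA : (A ∩ L.verts).Nonempty) : a ≤ L.outWeight A := by
  obtain ⟨v, hv, hmax⟩ := exists_max_image _ L.pos hA
  rw [mem_inter] at hv
  exact (ha v hv.2).trans (G.sum_weight_mono (leaving_singleton_subset hv.1 hmax))

/-- The hyperedges out of `A` leave `A ∪ B` or enter `B`, and those out of the last vertex leave
`A ∪ B`. -/
theorem outWeight_add_le_of_last_mem (hAB : Disjoint A B) {v : V} (hv : v ∈ B)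
    (hmax : ∀ u ∈ (A ∪ B) ∩ L.verts, L.pos u ≤ L.pos v) :
    L.outWeight A + L.outWeight {v} ≤ L.outWeight (A ∪ B) + L.inWeight B := by
  have hlast := leaving_singleton_subset (mem_union_right A hv) hmax
  have hsplit : L.leaving A ⊆ (L.leaving (A ∪ B) \ L.leaving {v}) ∪ L.entering B := by
    intro e he
    simp only [mem_union, mem_sdiff, mem_leaving, mem_entering, mem_singleton] at he ⊢
    have hB := disjoint_left.1 hAB he.2.1
    grind
  have hsub := (G.sum_weight_mono hsplit).trans (G.sum_weight_union_le _ _)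
  rw [sum_sdiff_eq_sub hlast] at hsub
  unfold outWeight inWeight
  linarith

theorem outWeight_add_le_of_pos_eq_zero {u v : V} (huv : u ≠ v) (hu : u ∈ A) (hv : v ∈ A)
    (hA : ∀ x ∈ A ∩ L.verts, L.pos x = 0) :
    L.outWeight {u} + L.outWeight {v} ≤ L.outWeight A := by
  rw [outWeight, outWeight, ← sum_union]
  · exact G.sum_weight_mono <| union_subset
      (leaving_singleton_subset hu fun x hx => (hA x hx).trans_le (Nat.zero_le _))
      (leaving_singleton_subset hv fun x hx => (hA x hx).trans_le (Nat.zero_le _))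
  · exact disjoint_left.2 fun e heu hev =>
      huv ((mem_singleton.1 (mem_leaving.1 heu).2.1).symm.trans
        (mem_singleton.1 (mem_leaving.1 hev).2.1))

end Weights

section Potential

variable {V E : Type*} [DecidableEq V] [Fintype V] [DecidableEq E] [Fintype E]
  {G : TensorNetwork V E} (L : Linearization G)

/-- One unit if a weight of at least `α` enters a set of at least two vertices. -/
noncomputable def credit (α : ℝ) (A : Finset V) : ℤ :=
  if α ≤ L.inWeight A ∧ 2 ≤ #(A ∩ L.verts) then 1 else 0

/-- One unit if a weight of more than `β` leaves the set. -/
noncomputable def debit (β : ℝ) (A : Finset V) : ℤ := if β < L.outWeight A then 1 else 0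

/-- The number of mergers of sources inside `A`, corrected by whether `A` is about to be merged
expensively. It increases only at contractions of large weight. -/
noncomputable def potential (α β : ℝ) (A : Finset V) : ℤ :=
  (#(L.sources A) - 1 : ℕ) + L.credit α A - L.debit β A

theorem credit_nonneg (α : ℝ) (A : Finset V) : 0 ≤ L.credit α A := by
  unfold credit
  split_ifs <;> simp

theorem debit_nonneg (β : ℝ) (A : Finset V) : 0 ≤ L.debit β A := by
  unfold debit
  split_ifs <;> simp

variable {L} {A B : Finset V} {a α β x : ℝ}

theorem potential_congr (h : A ∩ L.verts = B ∩ L.verts) :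
    L.potential α β A = L.potential α β B := by
  simp only [potential, sources, credit, debit, h, outWeight_congr h, inWeight_congr h]

theorem potential_nonpos (h : #(A ∩ L.verts) ≤ 1) : L.potential α β A ≤ 0 := by
  have hsrc : #(L.sources A) - 1 = 0 :=
    Nat.sub_eq_zero_of_le ((card_le_card (filter_subset _ _)).trans h)
  have hcredit : L.credit α A = 0 := if_neg fun h' => by omega
  have := L.debit_nonneg β A
  rw [potential, hsrc, hcredit]
  omega

theorem potential_eq_zero (hβ : 0 ≤ β) (h : A ∩ L.verts = ∅) : L.potential α β A = 0 := by
  simp [potential, sources, credit, debit, h, outWeight_eq_zero h, hβ]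

theorem HasMinOutWeight.credit_eq_one (ha : L.HasMinOutWeight a)
    (hsrc : ∀ v ∈ L.verts, L.pos v = 0 → β < 2 * L.outWeight {v}) (hAB : Disjoint A B)
    (hA : (L.sources A).Nonempty) (hB : (L.sources B).Nonempty)
    (hout : L.outWeight (A ∪ B) ≤ β) {v : V} (hv : v ∈ B) (hvL : v ∈ L.verts)
    (hmax : ∀ u ∈ (A ∪ B) ∩ L.verts, L.pos u ≤ L.pos v) : L.credit (2 * a - β) B = 1 := by
  obtain ⟨u, hu⟩ := hA
  obtain ⟨w, hw⟩ := hB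
  simp only [sources, mem_filter, mem_inter] at hu hw
  refine if_pos ⟨?_, ?_⟩
  · have := outWeight_add_le_of_last_mem hAB hv hmax
    have := ha v hvL
    have := ha.le_outWeight ⟨u, mem_inter.2 hu.1⟩
    linarith
  · refine one_lt_card.2 ⟨v, mem_inter.2 ⟨hv, hvL⟩, w, mem_inter.2 hw.1, ?_⟩
    rintro rfl
    have huv : u ≠ v := fun h => disjoint_left.1 hAB hu.1.1 (h ▸ hv)
    have := outWeight_add_le_of_pos_eq_zero huv (mem_union_left B hu.1.1) (mem_union_right A hv)
      fun y hy => Nat.le_zero.1 (hw.2 ▸ hmax y hy)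
    have := hsrc u hu.1.2 hu.2
    have := hsrc v hvL hw.2
    linarith

theorem HasMinOutWeight.one_le_credit_add_credit_add_debit (ha : L.HasMinOutWeight a)
    (hsrc : ∀ v ∈ L.verts, L.pos v = 0 → β < 2 * L.outWeight {v}) (hAB : Disjoint A B)
    (hA : (L.sources A).Nonempty) (hB : (L.sources B).Nonempty) :
    1 ≤ L.credit (2 * a - β) A + L.credit (2 * a - β) B + L.debit β (A ∪ B) := by
  have := L.credit_nonneg (2 * a - β) A
  have := L.credit_nonneg (2 * a - β) B
  rcases lt_or_ge β (L.outWeight (A ∪ B)) with hout | hout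
  · have : L.debit β (A ∪ B) = 1 := if_pos hout
    omega
  have := L.debit_nonneg β (A ∪ B)
  obtain ⟨v, hv, hmax⟩ := exists_max_image ((A ∪ B) ∩ L.verts) L.pos <|
    hA.mono ((filter_subset _ _).trans (inter_subset_inter_right subset_union_left))
  rw [mem_inter, mem_union] at hv
  obtain ⟨hvA | hvB, hvL⟩ := hv
  · rw [union_comm] at hout hmax
    have := ha.credit_eq_one hsrc hAB.symm hB hA hout hvA hvL hmax
    omega
  · have := ha.credit_eq_one hsrc hAB hA hB hout hvB hvL hmax
    omega

theorem HasMinOutWeight.card_sources_union_sub_one_le (ha : L.HasMinOutWeight a)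
    (hsrc : ∀ v ∈ L.verts, L.pos v = 0 → β < 2 * L.outWeight {v}) (hAB : Disjoint A B) :
    ((#(L.sources (A ∪ B)) - 1 : ℕ) : ℤ) ≤ (#(L.sources A) - 1 : ℕ) + (#(L.sources B) - 1 : ℕ) +
      (L.credit (2 * a - β) A + L.credit (2 * a - β) B + L.debit β (A ∪ B)) := by
  have := L.credit_nonneg (2 * a - β) A
  have := L.credit_nonneg (2 * a - β) B
  have := L.debit_nonneg β (A ∪ B)
  rw [card_sources_union hAB]
  rcases (L.sources A).eq_empty_or_nonempty with hA | hA
  · rw [hA, card_empty]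
    omega
  rcases (L.sources B).eq_empty_or_nonempty with hB | hB
  · rw [hB, card_empty]
    omega
  have := ha.one_le_credit_add_credit_add_debit hsrc hAB hA hB
  omega

theorem HasMinOutWeight.credit_add_debit_add_debit_le (ha : L.HasMinOutWeight a)
    (hxβ : x ≤ β + a) (hxa : x ≤ 4 * a - β) (hA : (A ∩ L.verts).Nonempty)
    (hB : (B ∩ L.verts).Nonempty) :
    L.credit (2 * a - β) (A ∪ B) + L.debit β A + L.debit β B ≤
      3 * if x ≤ L.contractionWeight A B then 1 else 0 := by
  have haA := ha.le_outWeight hA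
  have haB := ha.le_outWeight hB
  have hin := L.inWeight_nonneg (A ∪ B)
  unfold contractionWeight
  split_ifs with hx
  · unfold credit debit
    split_ifs <;> norm_num
  · have hcredit : L.credit (2 * a - β) (A ∪ B) = 0 := if_neg fun h => hx (by linarith [h.1])
    have hdebitA : L.debit β A = 0 := if_neg fun h => hx (by linarith)
    have hdebitB : L.debit β B = 0 := if_neg fun h => hx (by linarith)
    omega

theorem HasMinOutWeight.potential_union_le (ha : L.HasMinOutWeight a)
    (hsrc : ∀ v ∈ L.verts, L.pos v = 0 → β < 2 * L.outWeight {v}) (hβ : 0 ≤ β)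
    (hxβ : x ≤ β + a) (hxa : x ≤ 4 * a - β) (hAB : Disjoint A B) :
    L.potential (2 * a - β) β (A ∪ B) ≤ L.potential (2 * a - β) β A + L.potential (2 * a - β) β B +
      3 * if x ≤ L.contractionWeight A B then 1 else 0 := by
  have hcharge : (0 : ℤ) ≤ if x ≤ L.contractionWeight A B then 1 else 0 := by split_ifs <;> simp
  rcases (A ∩ L.verts).eq_empty_or_nonempty with hA | hA
  · rw [potential_eq_zero hβ hA, potential_congr (B := B)]
    · omega
    · rw [union_inter_distrib_right, hA, empty_union]
  rcases (B ∩ L.verts).eq_empty_or_nonempty with hB | hB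
  · rw [potential_eq_zero hβ hB, potential_congr (B := A)]
    · omega
    · rw [union_inter_distrib_right, hB, union_empty]
  have hmerge := ha.card_sources_union_sub_one_le hsrc hAB
  have hexpensive := ha.credit_add_debit_add_debit_le hxβ hxa hA hB
  unfold potential
  omega

theorem HasMinOutWeight.potential_verts_le (ha : L.HasMinOutWeight a)
    (hsrc : ∀ v ∈ L.verts, L.pos v = 0 → β < 2 * L.outWeight {v}) (hβ : 0 ≤ β)
    (hxβ : x ≤ β + a) (hxa : x ≤ 4 * a - β) {T : ContractionTree V} (hT : T.Proper) :
    L.potential (2 * a - β) β T.verts ≤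
      3 * #{p ∈ T.contractions | x ≤ L.contractionWeight p.1 p.2} := by
  induction T with
  | leaf v =>
    refine (potential_nonpos ?_).trans (by positivity)
    exact (card_le_card inter_subset_left).trans_eq (card_singleton v)
  | node l r hl hr =>
    have hunion := ha.potential_union_le hsrc hβ hxβ hxa hT.2.2
    have hl := hl hT.1
    have hr := hr hT.2.1
    rw [card_filter] at hl hr ⊢
    rw [hT.sum_contractions_node, ContractionTree.verts]
    push_cast at hl hr ⊢
    linarith

end Potential

end Linearization

end TensorNetwork

theorem disjoint_toLeft {V W : Type*} {A B : Finset (V ⊕ W)} (h : Disjoint A B) :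
    Disjoint A.toLeft B.toLeft :=
  disjoint_left.2 fun _ hA hB => disjoint_left.1 h (mem_toLeft.1 hA) (mem_toLeft.1 hB)

namespace DataNetwork

section

variable {VD ED : Type*} [DecidableEq VD] {D : DataNetwork VD ED} {A B : Finset VD}
  {j : D.Sketched}

theorem mem_sketchedAt : j ∈ D.sketchedAt A ↔ D.vertex j ∈ A := by
  simp [sketchedAt]

theorem sketchedAt_singleton : D.sketchedAt {D.vertex j} = {j} := by
  ext k
  simp [mem_sketchedAt, D.vertex_injective.eq_iff]

theorem vertex_mem_of_sketchedAt_eq (h : D.sketchedAt A = {j}) : D.vertex j ∈ A :=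
  mem_sketchedAt.1 (h ▸ mem_singleton_self j)

end

section Rest

variable {VD ED : Type*} [Fintype VD] [DecidableEq VD] [Fintype ED] [DecidableEq ED]
  (D : DataNetwork VD ED)

theorem rest_logCost {A B : Finset VD} (h : Disjoint A B) :
    D.rest.logCost A B =
      ∑ e ∈ (univ \ D.sketched) ∩ (D.edgesOut A ∪ D.edgesOut B), D.weight e :=
  TensorNetwork.restrict_logCost _ h

theorem aSize_mul_bSize_mul_cSize_mul_dSize (p : Finset VD × Finset VD) :
    D.aSize p * D.bSize p * D.cSize p * D.dSize p = Real.exp (D.rest.logCost p.1 p.2) := by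
  have hd : D.dSize p ≠ 0 := by
    unfold dSize aSize cSize
    positivity
  calc D.aSize p * D.bSize p * D.cSize p * D.dSize p
      = D.aSize p * D.cSize p * (D.bSize p * D.dSize p) := by ring
    _ = D.aSize p * D.cSize p * Real.exp (D.rest.cutBetween p.1 p.2) := by
      rw [bSize, div_mul_cancel₀ _ hd]
    _ = Real.exp (D.rest.logCost p.1 p.2) := by
      rw [aSize, cSize, ← Real.exp_add, ← Real.exp_add, TensorNetwork.logCost]
      ring_nf

end Rest

section Subnet

variable {VD ED : Type*} [DecidableEq VD] [DecidableEq ED] {D : DataNetwork VD ED}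
  {T₀ : ContractionTree VD}

theorem vertex_mem_subnet (j : D.Sketched) : D.vertex j ∈ D.subnet T₀ j := mem_insert_self _ _

theorem union_subset_subnet {j : D.Sketched} {A B : Finset VD} (hAB : T₀.Contracts A B)
    (h : D.sketchedAt (A ∪ B) = {j}) : A ∪ B ⊆ D.subnet T₀ j := by
  have hsub {p : Finset VD × Finset VD} (hp : p ∈ D.classD T₀ j) : p.1 ∪ p.2 ⊆ D.subnet T₀ j :=
    (subset_biUnion_of_mem (fun p : Finset VD × Finset VD => p.1 ∪ p.2) hp).trans
      (subset_insert _ _)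
  rcases hAB with hAB | hBA
  · exact hsub (mem_filter.2 ⟨hAB, h⟩)
  · rw [union_comm] at h ⊢
    exact hsub (mem_filter.2 ⟨hBA, h⟩)

theorem verts_subset_subnet {j : D.Sketched} {s : ContractionTree VD} (hs : s.IsSubtree T₀)
    (h : D.sketchedAt s.verts = {j}) : s.verts ⊆ D.subnet T₀ j := by
  cases s with
  | leaf v =>
    rw [ContractionTree.verts, ← mem_singleton.1 (vertex_mem_of_sketchedAt_eq h)]
    exact singleton_subset_iff.2 (vertex_mem_subnet j)
  | node l r =>
    exact union_subset_subnet (.inl (ContractionTree.mem_contractions_iff.2 ⟨l, r, hs, rfl⟩)) h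

theorem exists_isSubtree_subnet (hT₀ : T₀.Proper) {j : D.Sketched}
    (hj : D.vertex j ∈ T₀.verts) :
    ∃ s : ContractionTree VD, s.IsSubtree T₀ ∧ s.verts = D.subnet T₀ j ∧
      D.sketchedAt s.verts = {j} := by
  have hfin : {M | ∃ s : ContractionTree VD,
      s.IsSubtree T₀ ∧ s.verts = M ∧ D.sketchedAt M = {j}}.Finite :=
    T₀.verts.powerset.finite_toSet.subset fun _ ⟨_, hs, hsM, _⟩ =>
      mem_coe.2 (mem_powerset.2 (hsM ▸ hs.verts_subset))
  obtain ⟨_, ⟨⟨s, hs, rfl, hsj⟩, hmax⟩⟩ := hfin.exists_maximal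
    ⟨_, _, ContractionTree.isSubtree_leaf hj, rfl, sketchedAt_singleton⟩
  refine ⟨s, hs, (verts_subset_subnet hs hsj).antisymm ?_, hsj⟩
  refine insert_subset (vertex_mem_of_sketchedAt_eq hsj) (biUnion_subset.2 fun p hp => ?_)
  obtain ⟨hp, hpj⟩ := mem_filter.1 hp
  obtain ⟨l, r, ht, rfl⟩ := ContractionTree.mem_contractions_iff.1 hp
  rcases hT₀.trichotomy hs ht with h | h | h
  · exact hmax ⟨_, ht, rfl, hpj⟩ h.verts_subset
  · exact h.verts_subset
  · exact (disjoint_left.1 h (vertex_mem_of_sketchedAt_eq hsj)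
      (vertex_mem_of_sketchedAt_eq hpj)).elim

theorem sketchedAt_subset_of_subset_subnet (hT₀ : T₀.Proper) {j : D.Sketched}
    (hj : D.vertex j ∈ T₀.verts) {A : Finset VD} (hA : A ⊆ D.subnet T₀ j) :
    D.sketchedAt A ⊆ {j} := by
  obtain ⟨s, -, hs, hsj⟩ := exists_isSubtree_subnet hT₀ hj
  rw [← hsj, hs]
  exact fun k hk => mem_sketchedAt.2 (hA (mem_sketchedAt.1 hk))

theorem exists_contracts_subnet (hT₀ : T₀.Proper) {t : ContractionTree VD}
    (ht : t.IsSubtree T₀) {j : D.Sketched} (hj : D.vertex j ∈ t.verts)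
    (hne : ¬t.verts ⊆ D.subnet T₀ j) :
    ∃ Z k, t.Contracts (D.subnet T₀ j) Z ∧ D.vertex k ∈ Z := by
  obtain ⟨s, hs, hsX, hsj⟩ := exists_isSubtree_subnet hT₀ (ht.verts_subset hj)
  have hst : s.IsSubtree t := by
    rcases hT₀.trichotomy hs ht with h | h | h
    · exact h
    · exact (hne (hsX ▸ h.verts_subset)).elim
    · exact (disjoint_right.1 h hj (vertex_mem_of_sketchedAt_eq hsj)).elim
  obtain ⟨Z, hsZ⟩ := hst.exists_parent fun h => hne (h ▸ hsX).subset
  rw [hsX] at hsZ hsj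
  suffices hZ : ∃ k, D.vertex k ∈ Z from ⟨Z, hZ.choose, hsZ, hZ.choose_spec⟩
  by_contra! hZ
  have hunion : D.sketchedAt (D.subnet T₀ j ∪ Z) = {j} := by
    rw [← hsj]
    ext k
    simp [mem_sketchedAt, hZ k]
  obtain ⟨z, hz⟩ := hsZ.symm.left_nonempty
  exact disjoint_right.1 (hsZ.disjoint (ht.proper hT₀)) hz
    (union_subset_subnet (hsZ.of_isSubtree ht) hunion (mem_union_right _ hz))

theorem pairwise_disjoint_subnet (hT₀ : T₀.Proper)
    (hv : ∀ j, D.vertex j ∈ T₀.verts) : Pairwise (Function.onFun Disjoint (D.subnet T₀)) := by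
  intro j k hjk
  obtain ⟨s, hs, hsX, hsj⟩ := exists_isSubtree_subnet hT₀ (hv j)
  obtain ⟨t, ht, htX, htk⟩ := exists_isSubtree_subnet hT₀ (hv k)
  rw [Function.onFun, ← hsX, ← htX]
  rcases hT₀.trichotomy hs ht with h | h | h
  · have hj : j ∈ D.sketchedAt t.verts :=
      mem_sketchedAt.2 (h.verts_subset (vertex_mem_of_sketchedAt_eq hsj))
    rw [htk, mem_singleton] at hj
    exact (hjk hj).elim
  · have hk : k ∈ D.sketchedAt s.verts :=
      mem_sketchedAt.2 (h.verts_subset (vertex_mem_of_sketchedAt_eq htk))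
    rw [hsj, mem_singleton] at hk
    exact (hjk hk.symm).elim
  · exact h

end Subnet

section WithMatrix

variable {VD ED : Type*} [Fintype VD] [DecidableEq VD] [Fintype ED] [DecidableEq ED]
  {D : DataNetwork VD ED} {j : D.Sketched} {m : ℕ} {hm : 0 < m} {A B : Finset (VD ⊕ Unit)}

theorem inl_mem_edgesOut_withMatrix {e : ED} (he : e ≠ j.1) :
    Sum.inl e ∈ (D.withMatrix j m hm).edgesOut A ↔ e ∈ D.edgesOut A.toLeft := by
  simp [TensorNetwork.mem_edgesOut, withMatrix, he]

theorem sketched_mem_edgesOut_withMatrix : Sum.inl j.1 ∈ (D.withMatrix j m hm).edgesOut A ↔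
    (Sum.inl (D.vertex j) ∈ A ↔ Sum.inr () ∉ A) := by
  simp only [withMatrix, ne_eq, decide_not, TensorNetwork.mem_edgesOut, D.inc_sketched j,
    ↓reduceIte, Sum.exists, inl_mem_disjSum, mem_singleton, exists_eq_left, inr_mem_disjSum,
    true_and, decide_true, Bool.not_true, Bool.and_false, Bool.false_eq_true, false_or]
  tauto

theorem inr_mem_edgesOut_withMatrix :
    Sum.inr () ∈ (D.withMatrix j m hm).edgesOut A ↔ Sum.inr () ∈ A := by
  simp [TensorNetwork.mem_edgesOut, withMatrix]

theorem vertex_mem_of_mem_edgesOut {k : D.Sketched} {A : Finset VD} (h : k.1 ∈ D.edgesOut A) :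
    D.vertex k ∈ A := by
  obtain ⟨v, hv, hvA⟩ := (TensorNetwork.mem_edgesOut.1 h).1
  rw [D.inc_sketched, mem_singleton] at hv
  exact hv ▸ hvA

theorem withMatrix_logCost_le (h : Disjoint A B)
    (hsketched : D.sketchedAt (A.toLeft ∪ B.toLeft) ⊆ {j}) :
    (D.withMatrix j m hm).logCost A B ≤ D.rest.logCost A.toLeft B.toLeft +
      (if Sum.inl j.1 ∈ (D.withMatrix j m hm).edgesOut A ∪ (D.withMatrix j m hm).edgesOut B
        then Real.log (D.size j.1) else 0) +
      (if Sum.inr () ∈ A ∪ B then Real.log m else 0) := by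
  rw [TensorNetwork.logCost_eq_sum h, D.rest_logCost (disjoint_toLeft h),
    sum_sum_eq_sum_toLeft_add_sum_toRight]
  set F := (D.withMatrix j m hm).edgesOut A ∪ (D.withMatrix j m hm).edgesOut B with hF
  refine add_le_add ?_ (le_of_eq ?_)
  · rw [← sum_filter_not_add_sum_filter _ (· = j.1), filter_eq']
    refine add_le_add (D.sum_weight_mono fun e he => ?_) (le_of_eq ?_)
    · obtain ⟨heF, hej⟩ := mem_filter.1 he
      rw [mem_toLeft, hF, mem_union, inl_mem_edgesOut_withMatrix hej,
        inl_mem_edgesOut_withMatrix hej] at heF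
      refine mem_inter.2 ⟨mem_sdiff.2 ⟨mem_univ e, fun he => hej ?_⟩, mem_union.2 heF⟩
      have hmem : (⟨e, he⟩ : D.Sketched) ∈ D.sketchedAt (A.toLeft ∪ B.toLeft) :=
        mem_sketchedAt.2 <| mem_union.2 <|
          heF.imp (vertex_mem_of_mem_edgesOut (k := ⟨e, he⟩)) vertex_mem_of_mem_edgesOut
      exact congrArg Subtype.val (mem_singleton.1 (hsketched hmem))
    · simp only [mem_toLeft, TensorNetwork.weight, withMatrix]
      split_ifs
      exacts [sum_singleton _ _, sum_empty]
  · have hunit : () ∈ F.toRight ↔ Sum.inr () ∈ A ∪ B := by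
      rw [mem_toRight, hF, mem_union, inr_mem_edgesOut_withMatrix, inr_mem_edgesOut_withMatrix,
        mem_union]
    rw [← sum_ite_mem_eq, Fintype.sum_unique]
    exact if_congr hunit rfl rfl

theorem withMatrix_logCost_extend_le {P A B : Finset VD} (hj : D.vertex j ∈ P)
    (h : Disjoint A B) (hsketched : D.sketchedAt (A ∪ B) ⊆ {j}) :
    (D.withMatrix j m hm).logCost (ContractionTree.extend P A) (ContractionTree.extend P B) ≤
      D.rest.logCost A B + if P ⊆ A ∨ P ⊆ B then Real.log m else
        if D.vertex j ∈ A ∪ B then Real.log (D.size j.1) else 0 := by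
  have hle := withMatrix_logCost_le (hm := hm) (ContractionTree.disjoint_extend ⟨_, hj⟩ h)
    (by rwa [ContractionTree.toLeft_extend, ContractionTree.toLeft_extend])
  rw [ContractionTree.toLeft_extend, ContractionTree.toLeft_extend] at hle
  refine hle.trans_eq ?_
  have hA : P ⊆ A → D.vertex j ∈ A ∧ D.vertex j ∉ B :=
    fun hP => ⟨hP hj, disjoint_left.1 h (hP hj)⟩
  have hB : P ⊆ B → D.vertex j ∈ B ∧ D.vertex j ∉ A :=
    fun hP => ⟨hP hj, disjoint_right.1 h (hP hj)⟩
  simp only [mem_union, sketched_mem_edgesOut_withMatrix, ContractionTree.inl_mem_extend,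
    ContractionTree.inr_mem_extend]
  split_ifs <;> first | (exfalso; tauto) | ring

theorem withMatrix_logCost_attach_le {P : Finset VD} (hsketched : D.sketchedAt P ⊆ {j}) :
    (D.withMatrix j m hm).logCost (P.disjSum ∅) {Sum.inr ()} ≤
      D.rest.cut P + Real.log (D.size j.1) + Real.log m := by
  have hright : ({Sum.inr ()} : Finset (VD ⊕ Unit)).toLeft = ∅ := rfl
  have hdisj : Disjoint (P.disjSum ∅) ({Sum.inr ()} : Finset (VD ⊕ Unit)) :=
    disjoint_singleton_right.2 (by simp)
  have hle := withMatrix_logCost_le (D := D) (j := j) (hm := hm) hdisj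
    (by rwa [toLeft_disjSum, hright, union_empty])
  rw [toLeft_disjSum, hright, TensorNetwork.logCost_empty] at hle
  have hs : 0 ≤ Real.log (D.size j.1) := D.weight_nonneg j.1
  refine hle.trans (add_le_add (add_le_add le_rfl ?_) (le_of_eq (if_pos (by simp))))
  split_ifs
  exacts [le_rfl, hs]

theorem sketchCost_le {T₀ s : ContractionTree VD} (hT₀ : T₀.Proper) (hj : D.vertex j ∈ T₀.verts)
    (hs : s.IsSubtree T₀) (hsX : s.verts ⊆ D.subnet T₀ j) :
    D.sketchCost T₀ j m hm ≤
      Real.exp ((D.withMatrix j m hm).logCost (s.verts.disjSum ∅) {Sum.inr ()}) +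
      ∑ p ∈ T₀.contractions with p.1 ∪ p.2 ⊆ D.subnet T₀ j, Real.exp ((D.withMatrix j m hm).logCost
        (ContractionTree.extend s.verts p.1) (ContractionTree.extend s.verts p.2)) := by
  obtain ⟨t, ht, htX, -⟩ := exists_isSubtree_subnet hT₀ hj
  obtain ⟨T', hT', hT'c⟩ := (hT₀.isSubtree_of_verts_subset hs ht (htX ▸ hsX)).exists_attach
    (ht.proper hT₀)
  rw [← htX] at hsX ⊢
  have hle : D.sketchCost T₀ j m hm ≤ T'.cost (D.withMatrix j m hm) := by
    refine csInf_le ⟨0, ?_⟩ ⟨T', htX ▸ hT', ?_, rfl⟩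
    · rintro _ ⟨T'', -, -, rfl⟩
      exact sum_nonneg fun _ _ => (Real.exp_pos _).le
    · rw [← htX, ← hT₀.contractions_eq_filter ht]
      exact fun p hp => ⟨_, hT'c ▸ mem_insert_of_mem (mem_image_of_mem _ hp),
        .inl ⟨ContractionTree.toLeft_extend _ _, ContractionTree.toLeft_extend _ _⟩⟩
  have hinj : Set.InjOn
      (Prod.map (ContractionTree.extend s.verts) (ContractionTree.extend s.verts))
      (t.contractions : Set (Finset VD × Finset VD)) :=
    ((Function.LeftInverse.injective (ContractionTree.toLeft_extend s.verts)).prodMap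
      (Function.LeftInverse.injective (ContractionTree.toLeft_extend s.verts))).injOn
  refine hle.trans ?_
  rw [ContractionTree.cost, hT'c, ← hT₀.contractions_eq_filter ht, insert_eq]
  refine (le_add_of_nonneg_right (sum_nonneg fun _ _ => (Real.exp_pos _).le)).trans_eq
    (sum_union_inter.trans ?_)
  rw [sum_singleton, sum_image hinj]
  rfl

end WithMatrix

end DataNetwork

namespace Embedding

section Linearization

variable {VD ED VE FE : Type*} [DecidableEq VD] [DecidableEq ED] [DecidableEq VE]
  {D : DataNetwork VD ED} (S : Embedding D VE FE)

theorem inc_sketched (j : D.Sketched) :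
    S.network.inc (Sum.inl j.1) = {Sum.inl (D.vertex j), Sum.inr (S.attach j)} := by
  ext (v | w) <;> simp [network, D.inc_sketched]

theorem card_inc_le_two {VD ED VE FE : Type*} [DecidableEq ED] [Fintype FE]
    {D : DataNetwork VD ED} (S : Embedding D VE FE) {e : ED ⊕ Option FE} (he : e ∈ S.edges) :
    #(S.network.inc e) ≤ 2 := by
  classical
  obtain e | _ | f := e
  · exact (S.inc_sketched ⟨e, inl_mem_disjSum.1 he⟩).symm ▸ card_le_two
  · exact (card_singleton _).trans_le one_le_two
  · simp [network, S.ends_card]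

variable [Fintype VE] [Fintype FE] (σ : VE ≃ Fin (Fintype.card VE))

/-- The embedding inside the overall network, with the data tensors ahead of the embedding tensors
and the latter ordered by `σ`. -/
def linearization : TensorNetwork.Linearization S.network where
  edges := S.edges
  verts := (univ.image D.vertex).disjSum univ
  pos := position σ
  inc_subset := by
    rintro (e | _ | f) he
    · rw [S.inc_sketched ⟨e, inl_mem_disjSum.1 he⟩]
      simp [insert_subset_iff]
    · simp [network]
    · rintro (v | w) hw
      · simp [network] at hw
      · exact inr_mem_disjSum.2 (mem_univ w)
  injOn := by
    rintro (e | _ | f) he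
    · rw [S.inc_sketched ⟨e, inl_mem_disjSum.1 he⟩, coe_pair]
      simp [Set.injOn_pair, position]
    · simp [network]
    · rintro (v | v) hv (w | w) hw h <;> simp_all [network, position, Fin.val_inj]

theorem inl_mem_linearization_verts {v : VD} :
    Sum.inl v ∈ (S.linearization σ).verts ↔ ∃ j, D.vertex j = v := by
  simp [linearization]

theorem inr_mem_linearization_verts (w : VE) : Sum.inr w ∈ (S.linearization σ).verts :=
  inr_mem_disjSum.2 (mem_univ w)

theorem card_sources_univ [Fintype VD] : #((S.linearization σ).sources univ) = D.order := by
  have hsources : (S.linearization σ).sources univ = univ.image (Sum.inl ∘ D.vertex) := by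
    ext (v | w)
    · simp [TensorNetwork.Linearization.sources, linearization, position]
    · simp [TensorNetwork.Linearization.sources, linearization, position]
  rw [hsources, card_image_of_injective _ (Sum.inl_injective.comp D.vertex_injective), card_univ,
    Fintype.card_coe, DataNetwork.order]

end Linearization

section Weights

variable {VD ED VE FE : Type*} [Fintype VD] [DecidableEq VD] [Fintype ED] [DecidableEq ED]
  [Fintype VE] [DecidableEq VE] [Fintype FE] [DecidableEq FE] {D : DataNetwork VD ED}
  (S : Embedding D VE FE) (σ : VE ≃ Fin (Fintype.card VE))

theorem cutLin_le_outWeight (A : Finset (VD ⊕ VE)) :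
    S.cutLin σ A ≤ (S.linearization σ).outWeight A := by
  refine S.network.sum_weight_mono fun e he => ?_
  obtain ⟨he, ⟨u, hu, v, hv, huA, hvA, huv⟩ | ⟨hd, hA⟩⟩ := mem_filter.1 he
  · refine TensorNetwork.Linearization.mem_leaving.2 ⟨he, ?_, .inr ⟨v, hv, hvA⟩⟩
    suffices hsrc : (S.linearization σ).src e = u from hsrc ▸ huA
    by_contra hne
    have hlt : position σ ((S.linearization σ).src e) < position σ v :=
      ((S.linearization σ).pos_src_le hu).trans_lt huv
    have hthree : 2 < #(S.network.inc e) := two_lt_card.2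
      ⟨_, (S.linearization σ).src_mem e, u, hu, v, hv, hne, fun h => (h ▸ hlt).false,
        fun h => (h ▸ huv).false⟩
    exact (S.card_inc_le_two he).not_gt hthree
  · exact TensorNetwork.Linearization.mem_leaving.2
      ⟨he, hA ((S.linearization σ).src_mem e), .inl hd⟩

theorem inl_mem_edgesOut_network {A : Finset (VD ⊕ VE)} {e : ED} (he : e ∉ D.sketched) :
    Sum.inl e ∈ S.network.edgesOut A ↔ e ∈ D.edgesOut A.toLeft := by
  simp [TensorNetwork.mem_edgesOut, network, he]

theorem rest_logCost_add_contractionWeight_le {A B : Finset (VD ⊕ VE)} (h : Disjoint A B) :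
    D.rest.logCost A.toLeft B.toLeft + (S.linearization σ).contractionWeight A B ≤
      S.network.logCost A B := by
  refine (add_le_add_right
    (TensorNetwork.Linearization.contractionWeight_le_sum h) _).trans ?_
  rw [D.rest_logCost (disjoint_toLeft h), TensorNetwork.logCost_eq_sum h]
  set R := (univ \ D.sketched) ∩ (D.edgesOut A.toLeft ∪ D.edgesOut B.toLeft)
  have hsketched : ∀ e ∈ R, e ∉ D.sketched := fun e he => (mem_sdiff.1 (mem_inter.1 he).1).2
  have hdisj : Disjoint (R.map .inl) (S.edges ∩ (S.network.edgesOut A ∪ S.network.edgesOut B)) := by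
    refine disjoint_left.2 fun _ he he' => ?_
    obtain ⟨e, heR, rfl⟩ := mem_map.1 he
    exact hsketched e heR (inl_mem_disjSum.1 (mem_inter.1 he').1)
  have hsum : ∑ e ∈ R, D.weight e = ∑ e ∈ R.map .inl, S.network.weight e :=
    (sum_map R .inl S.network.weight).symm
  rw [hsum]
  refine (sum_union hdisj).symm.trans_le <|
    S.network.sum_weight_mono (union_subset (fun _ he => ?_) inter_subset_right)
  obtain ⟨e, heR, rfl⟩ := mem_map.1 he
  have hout {C : Finset (VD ⊕ VE)} := S.inl_mem_edgesOut_network (A := C) (hsketched e heR)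
  exact mem_union.2 ((mem_union.1 (mem_inter.1 heR).2).imp hout.2 hout.2)

theorem log_size_le_outWeight {A : Finset (VD ⊕ VE)} {j : D.Sketched}
    (hj : Sum.inl (D.vertex j) ∈ A) (hA : A.toRight = ∅) :
    Real.log (D.size j.1) ≤ (S.linearization σ).outWeight A := by
  have hinc := S.inc_sketched j
  have hsrc : (S.linearization σ).src (Sum.inl j.1) = Sum.inl (D.vertex j) := by
    have hmem := (S.linearization σ).src_mem (Sum.inl j.1)
    rw [hinc, mem_insert, mem_singleton] at hmem
    refine hmem.resolve_right fun h => ?_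
    have hle := (S.linearization σ).pos_src_le (hinc ▸ mem_insert_self _ _)
    rw [h] at hle
    exact Nat.not_succ_le_zero _ hle
  have hleaving : Sum.inl j.1 ∈ (S.linearization σ).leaving A :=
    TensorNetwork.Linearization.mem_leaving.2 ⟨inl_mem_disjSum.2 j.2, hsrc ▸ hj, .inr
      ⟨Sum.inr (S.attach j), by simp [hinc], fun h => by simpa [hA] using mem_toRight.2 h⟩⟩
  exact single_le_sum (fun e _ => S.network.weight_nonneg e) hleaving

theorem outWeight_univ_le : (S.linearization σ).outWeight univ ≤ Real.log S.m := by
  have hleaving : (S.linearization σ).leaving univ ⊆ {Sum.inr none} := by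
    intro e he
    obtain ⟨he, -, hd | ⟨v, -, hv⟩⟩ := TensorNetwork.Linearization.mem_leaving.1 he
    · obtain e | _ | f := e
      · have := inl_mem_disjSum.1 he
        simp [network, this] at hd
      · exact mem_singleton_self _
      · cases hd
    · exact (hv (mem_univ v)).elim
  exact (S.network.sum_weight_mono hleaving).trans_eq (sum_singleton _ _)

theorem hasMinOutWeight {c : ℝ} (hc : 0 < c) (hc₁ : c ≤ 1)
    (hrow : ∀ v, c * S.m ≤ Real.exp (S.cutLin σ {Sum.inr v}))
    (hm : ∀ e ∈ D.sketched, S.m < D.size e) :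
    (S.linearization σ).HasMinOutWeight (Real.log c + Real.log S.m) := by
  have hm₀ : (0 : ℝ) < S.m := by exact_mod_cast S.m_pos
  rintro (v | w) hv
  · obtain ⟨j, rfl⟩ := (S.inl_mem_linearization_verts σ).1 hv
    have hlog : Real.log S.m ≤ Real.log (D.size j.1) :=
      Real.log_le_log hm₀ (by exact_mod_cast (hm j.1 j.2).le)
    have hcut := S.log_size_le_outWeight σ (mem_singleton_self (Sum.inl (D.vertex j))) rfl
    linarith [Real.log_nonpos hc.le hc₁]
  · rw [← Real.log_mul hc.ne' hm₀.ne']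
    exact ((Real.log_le_iff_le_exp (by positivity)).2 (hrow w)).trans (S.cutLin_le_outWeight σ _)

end Weights

end Embedding

namespace Embedding

section LowerBounds

variable {VD ED VE FE : Type*} [Fintype VD] [DecidableEq VD] [Fintype ED] [DecidableEq ED]
  [Fintype VE] [DecidableEq VE] [Fintype FE] [DecidableEq FE] {D : DataNetwork VD ED}
  (S : Embedding D VE FE) (σ : VE ≃ Fin (Fintype.card VE)) {A B : Finset (VD ⊕ VE)}

theorem rest_logCost_add_outWeight_le (h : Disjoint A B) :
    D.rest.logCost A.toLeft B.toLeft +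
      ((S.linearization σ).outWeight A + (S.linearization σ).outWeight B) ≤
        S.network.logCost A B := by
  have hle := S.rest_logCost_add_contractionWeight_le σ h
  have hin := (S.linearization σ).inWeight_nonneg (A ∪ B)
  unfold TensorNetwork.Linearization.contractionWeight at hle
  linarith

theorem contractionWeight_le_logCost (h : Disjoint A B) :
    (S.linearization σ).contractionWeight A B ≤ S.network.logCost A B := by
  have hle := S.rest_logCost_add_contractionWeight_le σ h
  have hrest : 0 ≤ D.rest.logCost A.toLeft B.toLeft := by
    rw [D.rest_logCost (disjoint_toLeft h)]
    exact sum_nonneg fun e _ => D.weight_nonneg e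
  linarith

variable {T : ContractionTree (VD ⊕ VE)} {T₀ : ContractionTree VD} {a γ : ℝ}
  {S σ} {j : D.Sketched}

theorem le_outWeight_of_vertex_mem (ha : (S.linearization σ).HasMinOutWeight a)
    (hj : Sum.inl (D.vertex j) ∈ A) : a ≤ (S.linearization σ).outWeight A :=
  ha.le_outWeight ⟨_, mem_inter.2 ⟨hj, (S.inl_mem_linearization_verts σ).2 ⟨j, rfl⟩⟩⟩

theorem exists_sketching_contraction (hT : T.IsTreeOf univ) (hT₀ : T₀.IsTreeOf univ)
    (hc : T.ConstrainedOn T₀) (ha : (S.linearization σ).HasMinOutWeight a) (j : D.Sketched) :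
    ∃ A B, T.Contracts A B ∧ Sum.inl (D.vertex j) ∈ A ∧ A.toRight = ∅ ∧
      A.toLeft ⊆ D.subnet T₀ j ∧ a ≤ (S.linearization σ).outWeight B := by
  obtain ⟨A, B, hAB, hjA, hA, w, hw⟩ := ContractionTree.exists_first_mixed_contraction
    (T := T) (v := D.vertex j) (w := S.out) (hT.2 ▸ mem_univ _) (hT.2 ▸ mem_univ _)
  by_cases hsub : A.toLeft ⊆ D.subnet T₀ j
  · exact ⟨A, B, hAB, hjA, hA, hsub, ha.le_outWeight
      ⟨_, mem_inter.2 ⟨mem_toRight.1 hw, S.inr_mem_linearization_verts σ w⟩⟩⟩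
  obtain ⟨s, hs, rfl⟩ := hAB.exists_isSubtree_left
  obtain ⟨t, ht, hts⟩ := hT.1.exists_isSubtree_toLeft hc hs ⟨_, mem_toLeft.2 hjA⟩
    (hT₀.2 ▸ subset_univ _)
  rw [← hts] at hsub
  obtain ⟨Z, k, hXZ, hk⟩ := DataNetwork.exists_contracts_subnet hT₀.1 ht
    (hts ▸ mem_toLeft.2 hjA) hsub
  obtain ⟨P, Q, hPQ, hP, hQ⟩ := hc.exists_contracts (hXZ.of_isSubtree ht)
  have hunion : P ∪ Q ⊆ s.verts :=
    hPQ.union_subset_of_toLeft_subset hT.1 hs (hP ▸ hXZ.left_nonempty)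
      (hQ ▸ hXZ.symm.left_nonempty) (by rw [hP, hQ, ← hts]; exact hXZ.union_subset)
  refine ⟨P, Q, hPQ, mem_toLeft.1 (hP ▸ DataNetwork.vertex_mem_subnet j),
    subset_empty.1 (hA ▸ toRight_subset_toRight (subset_union_left.trans hunion)), hP.subset,
    le_outWeight_of_vertex_mem ha (mem_toLeft.1 (hQ ▸ hk))⟩

theorem withMatrix_logCost_extend_le (ha : (S.linearization σ).HasMinOutWeight (γ + Real.log S.m))
    (hγ : γ ≤ 0) (hT : T.Proper) {s : ContractionTree (VD ⊕ VE)} (hs : s.IsSubtree T)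
    (hj : Sum.inl (D.vertex j) ∈ s.verts) (hpure : s.verts.toRight = ∅) (h : T.Contracts A B)
    (hsketched : D.sketchedAt (A.toLeft ∪ B.toLeft) ⊆ {j}) :
    γ + (D.withMatrix j S.m S.m_pos).logCost
        (ContractionTree.extend s.verts.toLeft A.toLeft)
        (ContractionTree.extend s.verts.toLeft B.toLeft) ≤ S.network.logCost A B := by
  have hle := DataNetwork.withMatrix_logCost_extend_le (hm := S.m_pos) (mem_toLeft.2 hj)
    (disjoint_toLeft (h.disjoint hT)) hsketched
  have hnet := S.rest_logCost_add_outWeight_le σ (h.disjoint hT)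
  have hA := (S.linearization σ).outWeight_nonneg A
  have hB := (S.linearization σ).outWeight_nonneg B
  split_ifs at hle with hP hjAB
  · rcases hP with hP | hP
    · have := le_outWeight_of_vertex_mem ha (mem_toLeft.1 (hP (mem_toLeft.2 hj)))
      linarith
    · have := le_outWeight_of_vertex_mem ha (mem_toLeft.1 (hP (mem_toLeft.2 hj)))
      linarith
  · have hunion : A ∪ B ⊆ s.verts := by
      rcases h.cases hT hs with h | h | h | h
      · exact h
      · exact (hP (.inl (toLeft_subset_toLeft h))).elim
      · exact (hP (.inr (toLeft_subset_toLeft h))).elim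
      · rw [← toLeft_union] at hjAB
        exact (disjoint_left.1 h hj (mem_toLeft.1 hjAB)).elim
    have hright {C : Finset (VD ⊕ VE)} (hC : C ⊆ A ∪ B) : C.toRight = ∅ :=
      subset_empty.1 (hpure ▸ toRight_subset_toRight (hC.trans hunion))
    rcases mem_union.1 hjAB with hj | hj
    · have := S.log_size_le_outWeight σ (mem_toLeft.1 hj) (hright subset_union_left)
      linarith
    · have := S.log_size_le_outWeight σ (mem_toLeft.1 hj) (hright subset_union_right)
      linarith
  · linarith

theorem withMatrix_logCost_attach_le (h : Disjoint A B) (hj : Sum.inl (D.vertex j) ∈ A)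
    (hpure : A.toRight = ∅) (hsketched : D.sketchedAt A.toLeft ⊆ {j})
    (hB : γ + Real.log S.m ≤ (S.linearization σ).outWeight B) :
    γ + (D.withMatrix j S.m S.m_pos).logCost (A.toLeft.disjSum ∅) {Sum.inr ()} ≤
      S.network.logCost A B := by
  have hattach := DataNetwork.withMatrix_logCost_attach_le (hm := S.m_pos) hsketched
  have hrest : D.rest.cut A.toLeft ≤ D.rest.logCost A.toLeft B.toLeft :=
    TensorNetwork.cut_le_logCost (disjoint_toLeft h)
  have hsize := S.log_size_le_outWeight σ hj hpure
  have hnet := S.rest_logCost_add_outWeight_le σ h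
  linarith

theorem sum_exp_withMatrix_logCost_le (hT : T.Proper) (hT₀ : T₀.IsTreeOf univ)
    (hc : T.ConstrainedOn T₀) (ha : (S.linearization σ).HasMinOutWeight (γ + Real.log S.m))
    (hγ : γ ≤ 0) {s : ContractionTree (VD ⊕ VE)} (hs : s.IsSubtree T)
    (hj : Sum.inl (D.vertex j) ∈ s.verts) (hpure : s.verts.toRight = ∅) :
    ∑ p ∈ T₀.contractions with p.1 ∪ p.2 ⊆ D.subnet T₀ j,
        Real.exp (γ + (D.withMatrix j S.m S.m_pos).logCost
          (ContractionTree.extend s.verts.toLeft p.1) (ContractionTree.extend s.verts.toLeft p.2)) ≤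
      ∑ q ∈ T.touching (D.subnet T₀ j), Real.exp (S.network.logCost q.1 q.2) := by
  refine ContractionTree.RespectsContractions.sum_le_sum_of_forall_contracts_le hT₀.1
    (filter_subset _ _) (fun p hp => hc p (mem_filter.1 hp).1)
    (f := fun A B => Real.exp (S.network.logCost A B))
    (fun A B => by rw [S.network.logCost_comm]) (fun _ _ => (Real.exp_pos _).le) ?_ ?_
  · intro p hp q hq hqp
    obtain ⟨hp, hpX⟩ := mem_filter.1 hp
    rw [← hqp] at hpX
    refine mem_filter.2 ⟨hq, ?_⟩
    rcases union_nonempty.1 (hqp ▸ (ContractionTree.fst_nonempty hp).mono subset_union_left)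
      with h | h
    · exact .inl ⟨h, subset_union_left.trans hpX⟩
    · exact .inr ⟨h, subset_union_right.trans hpX⟩
  · rintro ⟨_, _⟩ hp A B h rfl rfl
    exact Real.exp_le_exp.2 (withMatrix_logCost_extend_le ha hγ hT hs hj hpure h
      (DataNetwork.sketchedAt_subset_of_subset_subnet hT₀.1 (hT₀.2 ▸ mem_univ _)
        (mem_filter.1 hp).2))

theorem exp_mul_sketchCost_le (hT : T.IsTreeOf univ) (hT₀ : T₀.IsTreeOf univ)
    (hc : T.ConstrainedOn T₀) (ha : (S.linearization σ).HasMinOutWeight (γ + Real.log S.m))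
    (hγ : γ ≤ 0) (j : D.Sketched) : Real.exp γ * D.sketchCost T₀ j S.m S.m_pos ≤
      2 * ∑ q ∈ T.touching (D.subnet T₀ j), Real.exp (S.network.logCost q.1 q.2) := by
  obtain ⟨A, B, hAB, hjA, hpure, hAX, hB⟩ := exists_sketching_contraction hT hT₀ hc ha j
  obtain ⟨s, hs, rfl⟩ := hAB.exists_isSubtree_left
  have hne : s.verts.toLeft.Nonempty := ⟨_, mem_toLeft.2 hjA⟩
  obtain ⟨t, ht, hts⟩ := hT.1.exists_isSubtree_toLeft hc hs hne (hT₀.2 ▸ subset_univ _)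
  have hj : D.vertex j ∈ T₀.verts := hT₀.2 ▸ mem_univ _
  have hcost := DataNetwork.sketchCost_le (hm := S.m_pos) hT₀.1 hj ht (hts ▸ hAX)
  have hattach := withMatrix_logCost_attach_le (hAB.disjoint hT.1) hjA hpure
    (DataNetwork.sketchedAt_subset_of_subset_subnet hT₀.1 hj hAX) hB
  have htouching := hAB.le_sum_touching hne hAX
    (f := fun A B => Real.exp (S.network.logCost A B))
    (fun A B => by rw [S.network.logCost_comm]) (fun _ _ => (Real.exp_pos _).le)
  have hextend := sum_exp_withMatrix_logCost_le hT.1 hT₀ hc ha hγ hs hjA hpure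
  rw [hts] at hcost
  have hcost := mul_le_mul_of_nonneg_left hcost (Real.exp_pos γ).le
  rw [mul_add, mul_sum, ← Real.exp_add] at hcost
  simp only [← Real.exp_add] at hcost
  linarith [Real.exp_le_exp.2 hattach]

theorem exp_mul_sum_sketchCost_le (hT : T.IsTreeOf univ) (hT₀ : T₀.IsTreeOf univ)
    (hc : T.ConstrainedOn T₀) (ha : (S.linearization σ).HasMinOutWeight (γ + Real.log S.m))
    (hγ : γ ≤ 0) : Real.exp γ * ∑ j : D.Sketched, D.sketchCost T₀ j S.m S.m_pos ≤
      4 * T.cost S.network := by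
  have hdisj := DataNetwork.pairwise_disjoint_subnet (D := D) hT₀.1 fun j => hT₀.2 ▸ mem_univ _
  have htouching := T.sum_touching_le hdisj fun q => (Real.exp_pos (S.network.logCost q.1 q.2)).le
  calc Real.exp γ * ∑ j : D.Sketched, D.sketchCost T₀ j S.m S.m_pos
      ≤ ∑ j, 2 * ∑ q ∈ T.touching (D.subnet T₀ j), Real.exp (S.network.logCost q.1 q.2) := by
        rw [mul_sum]
        exact sum_le_sum fun j _ => exp_mul_sketchCost_le hT hT₀ hc ha hγ j
    _ ≤ 2 * (2 * T.cost S.network) := by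
        rw [← mul_sum]
        exact mul_le_mul_of_nonneg_left htouching zero_le_two
    _ = 4 * T.cost S.network := by ring

theorem sum_le_cost_of_forall_contracts_le (hT₀ : T₀.Proper) (hc : T.ConstrainedOn T₀)
    {C : Finset (Finset VD × Finset VD)} (hC : C ⊆ T₀.contractions)
    {F : Finset VD × Finset VD → ℝ}
    (hF : ∀ A B, (A.toLeft, B.toLeft) ∈ C → T.Contracts A B →
      F (A.toLeft, B.toLeft) ≤ Real.exp (S.network.logCost A B)) :
    ∑ p ∈ C, F p ≤ T.cost S.network :=
  ContractionTree.RespectsContractions.sum_le_sum_of_forall_contracts_le hT₀ hC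
    (fun p hp => hc p (hC hp)) (f := fun A B => Real.exp (S.network.logCost A B))
    (fun A B => by rw [S.network.logCost_comm]) (fun _ _ => (Real.exp_pos _).le)
    (fun _ _ q hq _ => hq) (by rintro ⟨_, _⟩ hp A B h rfl rfl; exact hF A B hp h)

theorem exp_mul_sum_classS_le (hT : T.Proper) (hT₀ : T₀.Proper) (hc : T.ConstrainedOn T₀)
    (ha : (S.linearization σ).HasMinOutWeight (γ + Real.log S.m)) :
    Real.exp (2 * γ) * ∑ p ∈ D.classS T₀,
        D.aSize p * D.bSize p * D.cSize p * D.dSize p * (S.m : ℝ) ^ 2 ≤ T.cost S.network := by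
  rw [mul_sum]
  refine sum_le_cost_of_forall_contracts_le hT₀ hc (filter_subset _ _) fun A B hp h => ?_
  obtain ⟨-, ⟨j, hj⟩, k, hk⟩ := mem_filter.1 hp
  have hA := le_outWeight_of_vertex_mem ha (mem_toLeft.1 (DataNetwork.mem_sketchedAt.1 hj))
  have hB := le_outWeight_of_vertex_mem ha (mem_toLeft.1 (DataNetwork.mem_sketchedAt.1 hk))
  have hnet := S.rest_logCost_add_outWeight_le σ (h.disjoint hT)
  rw [D.aSize_mul_bSize_mul_cSize_mul_dSize, ← Real.exp_log (Nat.cast_pos.2 S.m_pos),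
    ← Real.exp_nat_mul, ← Real.exp_add, ← Real.exp_add, Real.exp_le_exp]
  push_cast
  linarith

theorem exp_mul_sum_zCost_le (hT : T.Proper) (hT₀ : T₀.Proper) (hc : T.ConstrainedOn T₀)
    (ha : (S.linearization σ).HasMinOutWeight (γ + Real.log S.m)) (hγ : γ ≤ 0)
    {C : Finset (Finset VD × Finset VD)} (hC : C ⊆ T₀.contractions) :
    Real.exp γ * ∑ p ∈ C, S.zCost σ p ≤ T.cost S.network := by
  rw [mul_sum]
  refine sum_le_cost_of_forall_contracts_le hT₀ hc hC fun A B _ h => ?_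
  have hA := (S.linearization σ).outWeight_nonneg A
  have hB := (S.linearization σ).outWeight_nonneg B
  have hnet := S.rest_logCost_add_outWeight_le σ (h.disjoint hT)
  suffices hmin : ∃ y, min (Real.exp (S.cutLin σ ((A.toLeft ∪ B.toLeft).disjSum ∅))) S.m ≤
      Real.exp y ∧ γ + y ≤ (S.linearization σ).outWeight A + (S.linearization σ).outWeight B by
    obtain ⟨y, hmin, hy⟩ := hmin
    rw [zCost, D.aSize_mul_bSize_mul_cSize_mul_dSize]
    calc Real.exp γ * (Real.exp (D.rest.logCost A.toLeft B.toLeft) * min _ _)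
        ≤ Real.exp γ * (Real.exp (D.rest.logCost A.toLeft B.toLeft) * Real.exp y) := by gcongr
      _ ≤ Real.exp (S.network.logCost A B) := by
        rw [← Real.exp_add, ← Real.exp_add, Real.exp_le_exp]
        linarith
  by_cases hj : ∃ j, D.vertex j ∈ A.toLeft ∪ B.toLeft
  · obtain ⟨j, hj⟩ := hj
    refine ⟨Real.log S.m, (min_le_right _ _).trans_eq
      (Real.exp_log (Nat.cast_pos.2 S.m_pos)).symm, ?_⟩
    rcases mem_union.1 hj with hj | hj <;>
      linarith [le_outWeight_of_vertex_mem ha (mem_toLeft.1 hj)]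
  · have hcut : S.cutLin σ ((A.toLeft ∪ B.toLeft).disjSum ∅) ≤ 0 := by
      refine (S.cutLin_le_outWeight σ _).trans_eq
        (TensorNetwork.Linearization.outWeight_eq_zero ?_)
      refine eq_empty_of_forall_notMem fun v hv => ?_
      obtain ⟨hv, hvL⟩ := mem_inter.1 hv
      rcases v with v | w
      · obtain ⟨j, rfl⟩ := (S.inl_mem_linearization_verts σ).1 hvL
        exact hj ⟨j, inl_mem_disjSum.1 hv⟩
      · exact notMem_empty _ (inr_mem_disjSum.1 hv)
    exact ⟨0, (min_le_left _ _).trans (Real.exp_le_exp.2 hcut), by linarith⟩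

theorem order_sub_one_le (hT : T.IsTreeOf univ)
    (ha : (S.linearization σ).HasMinOutWeight (γ + Real.log S.m)) (hγ : γ ≤ 0)
    (hm : ∀ e ∈ D.sketched, S.m < D.size e) :
    D.order - 1 ≤ 3 * #{p ∈ T.contractions |
      4 * γ + 5 / 2 * Real.log S.m ≤ (S.linearization σ).contractionWeight p.1 p.2} := by
  have hm₀ : (0 : ℝ) < S.m := Nat.cast_pos.2 S.m_pos
  have hlog : 0 ≤ Real.log S.m := Real.log_natCast_nonneg S.m
  have hsrc : ∀ v ∈ (S.linearization σ).verts, (S.linearization σ).pos v = 0 →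
      3 / 2 * Real.log S.m < 2 * (S.linearization σ).outWeight {v} := by
    rintro (v | w) hv hpos
    · obtain ⟨j, rfl⟩ := (S.inl_mem_linearization_verts σ).1 hv
      have hsize : Real.log S.m < Real.log (D.size j.1) :=
        Real.log_lt_log hm₀ (Nat.cast_lt.2 (hm j.1 j.2))
      have hout := S.log_size_le_outWeight σ (mem_singleton_self (Sum.inl (D.vertex j))) rfl
      linarith
    · exact (Nat.succ_ne_zero _ hpos).elim
  have hpot := ha.potential_verts_le (x := 4 * γ + 5 / 2 * Real.log S.m) hsrc (by positivity)
    (by linarith) (by linarith) hT.1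
  have hout := S.outWeight_univ_le σ
  have hdebit : (S.linearization σ).debit (3 / 2 * Real.log S.m) univ = 0 :=
    if_neg (by linarith)
  have hcredit := (S.linearization σ).credit_nonneg
    (2 * (γ + Real.log S.m) - 3 / 2 * Real.log S.m) univ
  rw [hT.2, TensorNetwork.Linearization.potential, hdebit, S.card_sources_univ σ] at hpot
  omega

theorem exp_mul_order_mul_rpow_le (hT : T.IsTreeOf univ)
    (ha : (S.linearization σ).HasMinOutWeight (γ + Real.log S.m)) (hγ : γ ≤ 0)
    (hm : ∀ e ∈ D.sketched, S.m < D.size e) (hN : 2 ≤ D.order) :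
    Real.exp (4 * γ) * (D.order * (S.m : ℝ) ^ (5 / 2 : ℝ)) ≤ 6 * T.cost S.network := by
  have hcount := order_sub_one_le hT ha hγ hm
  set x := 4 * γ + 5 / 2 * Real.log S.m with hx
  set N := #{p ∈ T.contractions | x ≤ (S.linearization σ).contractionWeight p.1 p.2} with hN_def
  have hmarkov : N * Real.exp x ≤ T.cost S.network := by
    rw [hN_def, ← nsmul_eq_mul]
    refine (card_nsmul_le_sum _ _ _ fun p hp => Real.exp_le_exp.2 ?_).trans
      (sum_le_sum_of_subset_of_nonneg (filter_subset _ _) fun _ _ _ => (Real.exp_pos _).le)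
    obtain ⟨hp, hxp⟩ := mem_filter.1 hp
    exact hxp.trans (S.contractionWeight_le_logCost σ
      (ContractionTree.Contracts.disjoint (.inl hp) hT.1))
  have hexp : Real.exp (4 * γ) * (S.m : ℝ) ^ (5 / 2 : ℝ) = Real.exp x := by
    rw [hx, Real.rpow_def_of_pos (Nat.cast_pos.2 S.m_pos), ← Real.exp_add, mul_comm (5 / 2 : ℝ)]
  have horder : (D.order : ℝ) ≤ 6 * N := by exact_mod_cast (by omega : D.order ≤ 6 * N)
  calc Real.exp (4 * γ) * (D.order * (S.m : ℝ) ^ (5 / 2 : ℝ))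
      = D.order * Real.exp x := by rw [← hexp]; ring
    _ ≤ 6 * N * Real.exp x := by gcongr
    _ ≤ 6 * T.cost S.network := by rw [mul_assoc]; gcongr

end LowerBounds

end Embedding

theorem exp_mul_le_of_le {γ γ' x y : ℝ} (hγ : γ' ≤ γ) (hy : 0 ≤ y) (h : Real.exp γ * x ≤ y) :
    Real.exp γ' * x ≤ y := by
  rcases le_or_gt x 0 with hx | hx
  · exact (mul_nonpos_of_nonneg_of_nonpos (Real.exp_pos _).le hx).trans hy
  · exact le_trans (by gcongr) h

theorem Embedding.Admissible.min_mul_le {VD ED VE FE : Type*} [DecidableEq VD]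
    [DecidableEq ED] [Fintype VE] [DecidableEq VE] [Fintype FE]
    {D : DataNetwork VD ED} {S : Embedding D VE FE} {σ : VE ≃ Fin (Fintype.card VE)}
    {κ κ₁ κ₂ ε δ : ℝ} (h : S.Admissible σ κ κ₁ κ₂ ε δ) (hκ : 0 < κ) (hκ₂ : 0 < κ₂) (v : VE) :
    min 1 (κ / κ₂) * S.m ≤ Real.exp (S.cutLin σ {Sum.inr v}) := by
  refine le_trans ?_ (h.1 v)
  calc min 1 (κ / κ₂) * S.m
      ≤ κ / κ₂ * (κ₂ * (Fintype.card VE * Real.log (1 / δ) / ε ^ 2)) :=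
        mul_le_mul (min_le_right _ _) h.2.2 (Nat.cast_nonneg _) (by positivity)
    _ = κ * (Fintype.card VE * Real.log (1 / δ) / ε ^ 2) := by
        rw [← mul_assoc, div_mul_cancel₀ _ hκ₂.ne']

theorem theoremE2_general {VD ED VE FE : Type*} [Fintype VD] [DecidableEq VD] [Fintype ED]
    [DecidableEq ED] [Fintype VE] [DecidableEq VE] [Fintype FE] [DecidableEq FE]
    {D : DataNetwork VD ED} {T₀ : ContractionTree VD} (hT₀ : T₀.IsTreeOf univ)
    (S : Embedding D VE FE) (σ : VE ≃ Fin (Fintype.card VE)) {c : ℝ} (hc₀ : 0 < c) (hc₁ : c ≤ 1)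
    (hrow : ∀ v, c * S.m ≤ Real.exp (S.cutLin σ {Sum.inr v}))
    (hm : ∀ e ∈ D.sketched, S.m < D.size e)
    {T : ContractionTree (VD ⊕ VE)} (hT : T.IsTreeOf univ) (hc : T.ConstrainedOn T₀) :
    c ^ 4 / 12 * (∑ j : D.Sketched, D.sketchCost T₀ j S.m S.m_pos
        + ∑ p ∈ D.classS T₀, D.aSize p * D.bSize p * D.cSize p * D.dSize p * (S.m : ℝ) ^ 2
        + (if 2 ≤ D.order then (D.order : ℝ) * (S.m : ℝ) ^ (5 / 2 : ℝ) else 0)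
        + ∑ p ∈ D.classI T₀, S.zCost σ p)
      ≤ T.cost S.network := by
  have ha := S.hasMinOutWeight σ hc₀ hc₁ hrow hm
  have hγ : Real.log c ≤ 0 := Real.log_nonpos hc₀.le hc₁
  have hcost : 0 ≤ T.cost S.network := sum_nonneg fun _ _ => (Real.exp_pos _).le
  have hexp : Real.exp (4 * Real.log c) = c ^ 4 := by
    rw [← Real.exp_log (pow_pos hc₀ 4), Real.log_pow, Nat.cast_ofNat]
  have hsketch := exp_mul_le_of_le (γ' := 4 * Real.log c) (by linarith) (by positivity)
    (Embedding.exp_mul_sum_sketchCost_le hT hT₀ hc ha hγ)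
  have hclassS := exp_mul_le_of_le (γ' := 4 * Real.log c) (by linarith) hcost
    (Embedding.exp_mul_sum_classS_le hT.1 hT₀.1 hc ha)
  have hclassI := exp_mul_le_of_le (γ' := 4 * Real.log c) (by linarith) hcost
    (Embedding.exp_mul_sum_zCost_le (C := D.classI T₀) hT.1 hT₀.1 hc ha hγ (filter_subset _ _))
  have horder : Real.exp (4 * Real.log c) *
      (if 2 ≤ D.order then (D.order : ℝ) * (S.m : ℝ) ^ (5 / 2 : ℝ) else 0) ≤
        6 * T.cost S.network := by
    split_ifs with hN
    · exact Embedding.exp_mul_order_mul_rpow_le hT ha hγ hm hN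
    · rw [mul_zero]
      positivity
  rw [hexp] at hsketch hclassS hclassI horder
  linarith

theorem theoremE2 (κ κ₁ κ₂ : ℝ) (hκ : 0 < κ) (hκ₁ : 0 < κ₁) (hκ₂ : 0 < κ₂) :
    ∃ C : ℝ, 0 < C ∧
      ∀ (VD ED VE FE : Type*) [Fintype VD] [DecidableEq VD] [Fintype ED] [DecidableEq ED]
        [Fintype VE] [DecidableEq VE] [Fintype FE] [DecidableEq FE]
        (ε δ : ℝ), 0 < ε → 0 < δ → δ < 1 →
      -- the data and a data contraction tree
      ∀ (D : DataNetwork VD ED) (T₀ : ContractionTree VD), T₀.IsTreeOf Finset.univ →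
      -- an embedding in `𝒢^(ε,δ)` whose sketch size is below the size of every sketched edge
      ∀ (S : Embedding D VE FE) (σ : VE ≃ Fin (Fintype.card VE)),
        S.Admissible σ κ κ₁ κ₂ ε δ →
        (∀ e ∈ D.sketched, S.m < D.size e) →
      -- a contraction tree of the overall network that is constrained on `T₀`
      ∀ T : ContractionTree (VD ⊕ VE), T.IsTreeOf Finset.univ → T.ConstrainedOn T₀ →
        C * (∑ j : D.Sketched, D.sketchCost T₀ j S.m S.m_pos
            + ∑ p ∈ D.classS T₀, D.aSize p * D.bSize p * D.cSize p * D.dSize p * (S.m : ℝ) ^ 2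
            + (if 2 ≤ D.order then (D.order : ℝ) * (S.m : ℝ) ^ (5 / 2 : ℝ) else 0)
            + ∑ p ∈ D.classI T₀, S.zCost σ p)
          ≤ T.cost S.network := by
  have hc : 0 < min 1 (κ / κ₂) := by positivity
  refine ⟨min 1 (κ / κ₂) ^ 4 / 12, by positivity, ?_⟩
  intro VD ED VE FE _ _ _ _ _ _ _ _ ε δ _ _ _ D T₀ hT₀ S σ hS hm T hT hTc
  exact theoremE2_general hT₀ S σ hc (min_le_left _ _) (hS.min_mul_le hκ hκ₂) hm hT hTc
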